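/- Let $R$ be a Dedekind domain with fraction field $K$, and let $E$ be the set of fractional ideals of $R$ in $K$ that contain $R$. A nonzero ideal $C\subseteq R$ is called Euclidean if there is a function $\psi\colon E\to\mathbb{N}=\{0,1,2,\dots\}$ such that for all $I\in E$ and all $x\in IC\setminus C$ there exists $y\in C$ with $\psi((x+y)^{-1}IC)<\psi(I)$; such a $\psi$ is called a Euclidean algorithm for $C$. When $R=\mathcal{O}_K$ is the ring of integers of a number field $K$, a nonzero ideal $C$ is called norm-Euclidean if $\psi(I)=\mathrm{Nm}(I^{-1})$ is a Euclidean algorithm for $C$; an ideal class is called norm-Euclidean if every nonzero ideal of $\mathcal{O}_K$ in it is norm-Euclidean. Theorem. Up to isomorphism, the imaginary quadratic fields $K$ whose ring of integers $\mathcal{O}_K$ has a Euclidean ideal are exactly the seven pairwise non-isomorphic fields $\mathbb{Q}(\sqrt{-D})$ with $D\in\{1,2,3,7,11\}$, which have class number $1$, and $D\in\{5,15\}$, which have class number $2$. In each of these seven fields there is exactly one ideal class that generates the class group, and this class is norm-Euclidean. -/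

import Mathlib

open scoped nonZeroDivisors NumberField

namespace EuclideanIdeal

/-- The set `E` of fractional ideals of `R` in `K` that contain `R` itself. -/
abbrev OverIdeal (R K : Type*) [CommRing R] [Field K] [Algebra R K] : Type _ :=
  {I : FractionalIdeal R⁰ K // 1 ≤ I}

/-- `ψ : E → ℕ` is a Euclidean algorithm for the ideal `C`: for all `I ∈ E` and all
`x ∈ IC ∖ C` there is `y ∈ C` with `ψ ((x + y)⁻¹ I C) < ψ I`.
The witness `J` is the fractional ideal `(x + y)⁻¹ I C`, viewed as an element of `E`. -/
def IsEuclideanAlgorithm {R K : Type*} [CommRing R] [IsDedekindDomain R] [Field K]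
    [Algebra R K] [IsFractionRing R K] (C : Ideal R) (ψ : OverIdeal R K → ℕ) : Prop :=
  ∀ (I : OverIdeal R K) (x : K),
    x ∈ I.1 * (C : FractionalIdeal R⁰ K) → x ∉ (C : FractionalIdeal R⁰ K) →
      ∃ y ∈ (C : FractionalIdeal R⁰ K), ∃ J : OverIdeal R K,
        J.1 = FractionalIdeal.spanSingleton R⁰ (x + y)⁻¹ * (I.1 * (C : FractionalIdeal R⁰ K)) ∧
          ψ J < ψ I

/-- The nonzero ideal `C` of `R` (a Dedekind domain with fraction field `K`) is Euclidean. -/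
def IsEuclidean {R : Type*} (K : Type*) [CommRing R] [IsDedekindDomain R] [Field K]
    [Algebra R K] [IsFractionRing R K] (C : Ideal R) : Prop :=
  C ≠ ⊥ ∧ ∃ ψ : OverIdeal R K → ℕ, IsEuclideanAlgorithm C ψ

/-- The nonzero ideal `C` of the ring of integers of a number field is norm-Euclidean:
`I ↦ Nm (I⁻¹)` (which is `ℕ`-valued on `E`) is a Euclidean algorithm for `C`. -/
def IsNormEuclidean {K : Type*} [Field K] [NumberField K] (C : Ideal (𝓞 K)) : Prop :=
  C ≠ ⊥ ∧ ∃ ψ : OverIdeal (𝓞 K) K → ℕ,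
    (∀ I, (ψ I : ℚ) = FractionalIdeal.absNorm (I.1⁻¹)) ∧ IsEuclideanAlgorithm C ψ

/-- Imaginary quadratic fields: degree `2` over `ℚ` and no real embedding. -/
structure IsImaginaryQuadratic (K : Type*) [Field K] [NumberField K] : Prop where
  finrank_eq_two : Module.finrank ℚ K = 2
  isTotallyComplex : NumberField.IsTotallyComplex K

/-- The field `ℚ(√-D)`, as a subfield of `ℂ`. -/
noncomputable def QSqrtNeg (D : ℕ) : IntermediateField ℚ ℂ :=
  IntermediateField.adjoin ℚ {Complex.I * ((Real.sqrt (D : ℝ) : ℝ) : ℂ)}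

/-- The class `c` generates the (cyclic) class group. -/
def GeneratesClassGroup {R : Type*} [CommRing R] [IsDomain R] (c : ClassGroup R) : Prop :=
  Subgroup.zpowers c = ⊤

end EuclideanIdeal

/-!
Two covering statements about the lattice `C` in the complex plane, where the norm is the squared
absolute value, carry the proof.

If the open discs of squared radius `Nm C` around the points of `C` cover `K`, then `C` is
norm-Euclidean (`IsNormCovering.isNormEuclidean`), because a step `I ↦ z⁻¹ I C` multiplies `Nm (I⁻¹)`
by `|Nm z| / Nm C`. The property depends only on the class of `C`. It is checked by rounding for the
unit ideal when `D = 1, 2, 3, 7, 11`, and for a nonprincipal ideal of norm `2` with principal square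
when `D = 5, 15`. As any Euclidean ideal generates the class group
(`IsEuclidean.generatesClassGroup`), this also yields the class numbers `1` and `2`, and with them the
uniqueness of the generating class.

Conversely, suppose that `C` has a Euclidean algorithm `ψ`, not necessarily given by the norm. If some
`x₀ ∈ K` had distance squared at least `ρ > Nm C` from all of `C`, then for each `I` with `Nm (I⁻¹)`
large the dense lattice `I C` would contain a point near `x₀` from which no step decreases
`Nm (I⁻¹)`; the ideals with `Nm (I⁻¹)` large would then admit an infinite descent of `ψ`
(`IsEuclideanAlgorithm.exists_norm_lt`). Applied to the circumcentre of the triangle spanned by a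
reduced basis of `C`, with normalized norm form `(a, b, c)`, this shows that the squared circumradius
`a c (a + c - b) / (4 a c - b ^ 2)` is at most `1`. Hence `c ≤ 3`, and since `K` is generated by a
square root of `b ^ 2 - 4 a c`, only the seven fields remain.
-/

namespace EuclideanIdeal

/-! ### Imaginary quadratic fields with an explicit generator -/

/-- `δ` generates the number field `K` over `ℚ` and `δ ^ 2 = -m` with `m > 0` rational. The generator is
kept explicit, so that elements of `K` are written `a + b * δ` with rational `a`, `b` and no ring of
integers has to be computed. -/
structure IsSqrtGen {K : Type*} [Field K] [NumberField K] (m : ℚ) (δ : K) : Prop where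
  pos : 0 < m
  sq : δ ^ 2 = -(m : K)
  span : ∀ x : K, ∃ a b : ℚ, x = a + b * δ

variable {K : Type*} [Field K] [NumberField K]

namespace IsSqrtGen

variable {m : ℚ} {δ : K}

theorem eq_zero_of_rat_add (h : IsSqrtGen m δ) {a b : ℚ} (hab : (a : K) + b * δ = 0) :
    a = 0 ∧ b = 0 := by
  have h1 : (a : K) ^ 2 = -((m : K) * b ^ 2) := by
    linear_combination (a - b * δ) * hab + b ^ 2 * h.sq
  have h2 : a ^ 2 = -(m * b ^ 2) := by exact_mod_cast h1
  have hb : b = 0 := by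
    by_contra hb
    have := mul_pos h.pos (pow_pos (abs_pos.2 hb) 2)
    rw [sq_abs] at this
    nlinarith [sq_nonneg a]
  subst hb
  exact ⟨by simpa using h2, rfl⟩

theorem rat_ext (h : IsSqrtGen m δ) {a b c d : ℚ} (hab : (a : K) + b * δ = c + d * δ) :
    a = c ∧ b = d := by
  have := h.eq_zero_of_rat_add (a := a - c) (b := b - d) (by push_cast; linear_combination hab)
  exact ⟨by linarith [this.1], by linarith [this.2]⟩

/-- The `ℚ`-basis `1, δ` of `K`. -/
noncomputable def basis (h : IsSqrtGen m δ) : Module.Basis (Fin 2) ℚ K :=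
  Module.Basis.mk (v := ![1, δ])
    (by
      rw [LinearIndependent.pair_iff]
      intro s t hst
      exact h.eq_zero_of_rat_add (by simpa [Rat.smul_def] using hst))
    (by
      rintro x -
      obtain ⟨a, b, rfl⟩ := h.span x
      rw [Matrix.range_cons, Matrix.range_cons, Matrix.range_empty, Set.union_empty,
        Set.singleton_union, Submodule.mem_span_pair]
      exact ⟨a, b, by simp [Rat.smul_def]⟩)

theorem basis_repr (h : IsSqrtGen m δ) (a b : ℚ) :
    h.basis.repr ((a : K) + b * δ) = Finsupp.single 0 a + Finsupp.single 1 b := by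
  have : (a : K) + b * δ = a • h.basis 0 + b • h.basis 1 := by
    simp [basis, Rat.smul_def]
  rw [this]
  simp

theorem finrank_eq_two (h : IsSqrtGen m δ) : Module.finrank ℚ K = 2 := by
  rw [Module.finrank_eq_card_basis h.basis, Fintype.card_fin]

/-- The norm form in the coordinates `1, δ`. -/
theorem norm_eq (h : IsSqrtGen m δ) (a b : ℚ) :
    Algebra.norm ℚ ((a : K) + b * δ) = a ^ 2 + m * b ^ 2 := by
  have h1 : ((a : K) + b * δ) * h.basis 0 = (a : K) + b * δ := by simp [basis]
  have h2 : ((a : K) + b * δ) * h.basis 1 = ((-(m * b) : ℚ) : K) + (a : ℚ) * δ := by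
    rw [show h.basis 1 = δ by simp [basis]]
    push_cast
    linear_combination b * h.sq
  rw [Algebra.norm_eq_matrix_det h.basis, Matrix.det_fin_two]
  simp only [Algebra.leftMulMatrix_eq_repr_mul, h1, h2, basis_repr]
  simp
  ring

/-- There is a complex embedding for which the norm is the squared absolute value; this is what makes
the norm of an imaginary quadratic field accessible to the triangle inequality. -/
theorem exists_embedding (h : IsSqrtGen m δ) :
    ∃ φ : K →+* ℂ, (φ δ).re = 0 ∧ ∀ x, ((Algebra.norm ℚ x : ℚ) : ℝ) = ‖φ x‖ ^ 2 := by
  obtain ⟨φ⟩ : Nonempty (K →+* ℂ) := inferInstance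
  have hs : φ δ ^ 2 = -(m : ℂ) := by rw [← map_pow, h.sq]; simp
  have hre := congrArg Complex.re hs
  have him := congrArg Complex.im hs
  have hm : (0 : ℝ) < m := by exact_mod_cast h.pos
  simp only [pow_two, Complex.mul_re, Complex.mul_im, Complex.neg_re, Complex.neg_im,
    Complex.ratCast_re, Complex.ratCast_im] at hre him
  have h0 : (φ δ).re = 0 := by
    have : (φ δ).re * (φ δ).im = 0 := by linarith
    rcases mul_eq_zero.1 this with h | h
    · exact h
    · rw [h] at hre; nlinarith [mul_self_nonneg (φ δ).re]
  rw [h0] at hre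
  refine ⟨φ, h0, fun x => ?_⟩
  obtain ⟨a, b, rfl⟩ := h.span x
  rw [h.norm_eq, ← Complex.normSq_eq_norm_sq, Complex.normSq_apply]
  simp [h0]
  linear_combination ((b : ℝ) ^ 2) * hre

theorem norm_nonneg (h : IsSqrtGen m δ) (x : K) : 0 ≤ Algebra.norm ℚ x := by
  obtain ⟨a, b, rfl⟩ := h.span x
  rw [h.norm_eq]
  have := h.pos
  positivity

theorem isImaginaryQuadratic (h : IsSqrtGen m δ) : IsImaginaryQuadratic K := by
  refine ⟨h.finrank_eq_two, ⟨fun v => ?_⟩⟩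
  rw [← NumberField.InfinitePlace.not_isReal_iff_isComplex, NumberField.InfinitePlace.isReal_iff]
  intro hr
  set φ := v.embedding
  have hc : (starRingEnd ℂ) (φ δ) = φ δ := by
    have := RingHom.congr_fun hr δ
    simpa [NumberField.ComplexEmbedding.conjugate_coe_eq] using this
  obtain ⟨r, hr⟩ := Complex.conj_eq_iff_real.1 hc
  have hs : φ δ ^ 2 = -(m : ℂ) := by rw [← map_pow, h.sq]; simp
  rw [hr] at hs
  have hs' : r ^ 2 = -(m : ℝ) := by exact_mod_cast hs
  have hm : (0 : ℝ) < m := by exact_mod_cast h.pos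
  nlinarith [sq_nonneg r]

end IsSqrtGen

/-! ### Existence of generators and the fields `ℚ(√-D)` -/

/-- In a quadratic field every irrational element generates. -/
theorem exists_rat_add_rat_mul (hfr : Module.finrank ℚ K = 2) {y : K} (hy : ∀ a : ℚ, y ≠ a)
    (z : K) : ∃ a b : ℚ, z = a + b * y := by
  have hli : LinearIndependent ℚ ![1, y] := by
    rw [LinearIndependent.pair_iff]
    intro s t hst
    by_cases ht : t = 0
    · subst ht; simpa using hst
    · refine absurd ?_ (hy (-(s / t)))
      have ht' : (t : K) ≠ 0 := by exact_mod_cast ht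
      simp only [Rat.smul_def] at hst
      push_cast
      field_simp
      linear_combination hst
  have hsp := hli.span_eq_top_of_card_eq_finrank (by simp [hfr])
  have hz : z ∈ Submodule.span ℚ (Set.range ![1, y]) := hsp ▸ Submodule.mem_top
  rw [Matrix.range_cons, Matrix.range_cons, Matrix.range_empty, Set.union_empty,
      Set.singleton_union, Submodule.mem_span_pair] at hz
  obtain ⟨a, b, hab⟩ := hz
  exact ⟨a, b, by simp [← hab, Rat.smul_def]⟩

/-- Completing the square produces the generator; it is the absence of real embeddings that makes its
square negative. -/
theorem IsImaginaryQuadratic.exists_isSqrtGen (hK : IsImaginaryQuadratic K) :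
    ∃ (m : ℚ) (δ : K), IsSqrtGen m δ := by
  have hfr := hK.finrank_eq_two
  -- an element outside `ℚ`
  obtain ⟨x, hx⟩ : ∃ x : K, ∀ a : ℚ, x ≠ a := by
    by_contra! hcon
    have : Module.finrank ℚ K ≤ 1 := finrank_le_one 1 fun w => by
      obtain ⟨a, rfl⟩ := hcon w
      exact ⟨a, by simp [Rat.smul_def]⟩
    omega
  obtain ⟨a, b, hab⟩ := exists_rat_add_rat_mul hfr hx (x ^ 2)
  have hδ : ∀ c : ℚ, x - (b / 2 : ℚ) ≠ c := fun c hc => hx (c + (b / 2 : ℚ)) (by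
    push_cast at hc ⊢; linear_combination hc)
  refine ⟨-(a + b ^ 2 / 4), x - (b / 2 : ℚ), ?_, ?_, exists_rat_add_rat_mul hfr hδ⟩
  · by_contra! hneg
    -- a nonnegative square would make every embedding real
    obtain ⟨φ⟩ : Nonempty (K →+* ℂ) := inferInstance
    set δ := x - (b / 2 : ℚ) with hδdef
    have hsq : δ ^ 2 = ((a + b ^ 2 / 4 : ℚ) : K) := by
      rw [hδdef]; push_cast; linear_combination hab
    have hs : φ δ ^ 2 = (((a + b ^ 2 / 4 : ℚ) : ℝ) : ℂ) := by
      rw [← map_pow, hsq, map_ratCast, Complex.ofReal_ratCast]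
    have hnn : (0 : ℝ) ≤ ((a + b ^ 2 / 4 : ℚ) : ℝ) := by exact_mod_cast (by linarith)
    have hs' : φ δ ^ 2 = ((Real.sqrt ((a + b ^ 2 / 4 : ℚ) : ℝ) : ℝ) : ℂ) ^ 2 := by
      rw [hs, ← Complex.ofReal_pow, Real.sq_sqrt hnn]
    have hreal : (starRingEnd ℂ) (φ δ) = φ δ := by
      rcases sq_eq_sq_iff_eq_or_eq_neg.1 hs' with h | h <;> rw [h] <;> simp
    have hφ : NumberField.ComplexEmbedding.IsReal φ := by
      rw [NumberField.ComplexEmbedding.isReal_iff]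
      ext z
      obtain ⟨p, q, rfl⟩ := exists_rat_add_rat_mul hfr hδ z
      simp [NumberField.ComplexEmbedding.conjugate_coe_eq, hreal]
    have := hK.isTotallyComplex.isComplex (NumberField.InfinitePlace.mk φ)
    rw [NumberField.InfinitePlace.isComplex_mk_iff] at this
    exact this hφ
  · push_cast; linear_combination hab

/-- A rational multiple of the generator changes `m` by a rational square. -/
theorem IsSqrtGen.scale {m : ℚ} {δ : K} (h : IsSqrtGen m δ) {t : ℚ} (ht : t ≠ 0) :
    IsSqrtGen (t ^ 2 * m) ((t : K) * δ) := by
  refine ⟨mul_pos (by positivity) h.pos, ?_, fun x => ?_⟩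
  · push_cast; linear_combination (t : K) ^ 2 * h.sq
  · obtain ⟨a, b, rfl⟩ := h.span x
    have ht' : (t : K) ≠ 0 := by exact_mod_cast ht
    exact ⟨a, b / t, by push_cast; field_simp⟩

theorem QSqrtNeg_gen_sq (D : ℕ) :
    (Complex.I * ((Real.sqrt (D : ℝ) : ℝ) : ℂ)) ^ 2 = -(D : ℂ) := by
  rw [mul_pow, Complex.I_sq, ← Complex.ofReal_pow, Real.sq_sqrt (Nat.cast_nonneg D)]
  simp

/-- The bridge between the subfields `ℚ(√-D)` of `ℂ` and explicit generators. -/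
theorem nonempty_algEquiv_iff {D : ℕ} (hD : 0 < D) :
    Nonempty (K ≃ₐ[ℚ] QSqrtNeg D) ↔ ∃ δ : K, IsSqrtGen (D : ℚ) δ := by
  have hD' : (0 : ℚ) < D := by exact_mod_cast hD
  set g : ℂ := Complex.I * ((Real.sqrt (D : ℝ) : ℝ) : ℂ) with hg
  have hg2 : g ^ 2 = -(D : ℂ) := QSqrtNeg_gen_sq D
  constructor
  · rintro ⟨e⟩
    have hgm : g ∈ QSqrtNeg D := IntermediateField.mem_adjoin_simple_self ℚ g
    refine ⟨e.symm ⟨g, hgm⟩, hD', ?_, fun x => ?_⟩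
    · rw [← map_pow]
      have : (⟨g, hgm⟩ : QSqrtNeg D) ^ 2 = -((D : ℚ) : QSqrtNeg D) := by
        ext; simp [hg2]
      rw [this]; simp
    · have hint : IsIntegral ℚ g := IsIntegral.of_pow two_pos (by
        
        rw [hg2, show -(D : ℂ) = algebraMap ℚ ℂ (-(D : ℚ)) by simp]
        exact isIntegral_algebraMap)
      have hx : ((e x : QSqrtNeg D) : ℂ) ∈ Algebra.adjoin ℚ {g} := by
        rw [← IntermediateField.adjoin_simple_toSubalgebra_of_isAlgebraic hint.isAlgebraic]
        exact (e x).2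
      have hadj : ∀ y ∈ Algebra.adjoin ℚ {g}, ∃ a b : ℚ, y = a + b * g := by
        intro y hy
        induction hy using Algebra.adjoin_induction with
        | mem y hy => exact ⟨0, 1, by simp [Set.mem_singleton_iff.1 hy]⟩
        | algebraMap r => exact ⟨r, 0, by simp⟩
        | add y z _ _ hy hz =>
          obtain ⟨a, b, rfl⟩ := hy
          obtain ⟨c, d, rfl⟩ := hz
          exact ⟨a + c, b + d, by push_cast; ring⟩
        | mul y z _ _ hy hz =>
          obtain ⟨a, b, rfl⟩ := hy
          obtain ⟨c, d, rfl⟩ := hz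
          exact ⟨a * c - b * d * D, a * d + b * c, by
            push_cast; linear_combination (b : ℂ) * d * hg2⟩
      obtain ⟨a, b, hab⟩ := hadj _ hx
      refine ⟨a, b, e.injective ?_⟩
      ext
      simp [hab]
  · rintro ⟨δ, h⟩
    obtain ⟨φ⟩ : Nonempty (K →+* ℂ) := inferInstance
    let ψ : K →ₐ[ℚ] ℂ := φ.toRatAlgHom
    have hψ : ψ δ ^ 2 = g ^ 2 := by rw [← map_pow, h.sq, hg2]; simp
    have hr : ψ.fieldRange = QSqrtNeg D := by
      apply le_antisymm
      · rintro _ ⟨x, rfl⟩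
        obtain ⟨a, b, rfl⟩ := h.span x
        have hgm : g ∈ QSqrtNeg D := IntermediateField.mem_adjoin_simple_self ℚ g
        have hδ : ψ δ ∈ QSqrtNeg D := by
          rcases sq_eq_sq_iff_eq_or_eq_neg.1 hψ with h | h <;> rw [h]
          · exact hgm
          · exact neg_mem hgm
        have hrat : ∀ q : ℚ, (q : ℂ) ∈ QSqrtNeg D := fun q => by
          simp
        change ψ ((a : K) + b * δ) ∈ QSqrtNeg D
        rw [map_add, map_mul, map_ratCast, map_ratCast]
        exact add_mem (hrat a) (mul_mem (hrat b) hδ)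
      · rw [QSqrtNeg, IntermediateField.adjoin_simple_le_iff]
        rcases sq_eq_sq_iff_eq_or_eq_neg.1 hψ with h | h
        · exact ⟨δ, h⟩
        · exact ⟨-δ, by change ψ (-δ) = g; rw [map_neg, h, neg_neg]⟩
    exact ⟨(AlgEquiv.ofInjectiveField ψ).trans (IntermediateField.equivOfEq hr)⟩

/-- Two square roots `√-D`, `√-D'` in the same quadratic field are rational multiples of each other. -/
theorem isSquare_of_isSqrtGen {D D' : ℕ} {δ δ' : K} (h : IsSqrtGen (D : ℚ) δ)
    (h' : IsSqrtGen (D' : ℚ) δ') : IsSquare (D * D') := by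
  obtain ⟨a, b, hab⟩ := h.span δ'
  have h1 : ((a ^ 2 - D * b ^ 2 : ℚ) : K) + ((2 * a * b : ℚ) : K) * δ =
      ((-D' : ℚ) : K) + (0 : ℚ) * δ := by
    have := h'.sq
    rw [hab] at this
    have h2 := h.sq
    push_cast at this h2 ⊢
    linear_combination this - (b : K) ^ 2 * h2
  obtain ⟨h2, h3⟩ := h.rat_ext h1
  have hD' := h'.pos
  have ha : a = 0 := by
    by_contra ha
    have hb : b = 0 := by simpa [ha] using h3
    subst hb
    nlinarith [sq_nonneg a]
  subst ha
  rw [← Rat.isSquare_natCast_iff]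
  exact ⟨D * b, by push_cast; linear_combination (D : ℚ) * h2⟩

/-! ### Euclidean ideals have small covering radius -/

/-- Minkowski: every nonzero fractional ideal contains a nonzero element whose norm is bounded by a
constant times the norm of the ideal. Only the existence of the constant matters here. -/
theorem exists_small_mem_fractionalIdeal (K : Type*) [Field K] [NumberField K] :
    ∃ c : ℝ, 0 ≤ c ∧ ∀ I : FractionalIdeal (𝓞 K)⁰ K, I ≠ 0 → ∃ a ∈ I, a ≠ 0 ∧
      |((Algebra.norm ℚ a : ℚ) : ℝ)| ≤ c * (FractionalIdeal.absNorm I : ℚ) := by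
  refine ⟨(4 / Real.pi) ^ NumberField.InfinitePlace.nrComplexPlaces K *
        (Module.finrank ℚ K).factorial / (Module.finrank ℚ K) ^ (Module.finrank ℚ K) *
        Real.sqrt |NumberField.discr K|, by positivity, fun I hI => ?_⟩
  obtain ⟨a, ha, ha0, hle⟩ :=
    NumberField.exists_ne_zero_mem_ideal_of_norm_le_mul_sqrt_discr K (Units.mk0 I hI)
  refine ⟨a, ha, ha0, ?_⟩
  rw [Units.val_mk0] at hle
  push_cast at hle ⊢
  exact hle.trans (le_of_eq (by ring))

theorem IsSqrtGen.exists_integer_eq_den_mul {m : ℚ} {δ : K} (h : IsSqrtGen m δ) :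
    ∃ θ : 𝓞 K, algebraMap (𝓞 K) K θ = m.den * δ := by
  have hm : ((m.num : K) / m.den) = m := by exact_mod_cast m.num_div_den
  have hd : (m.den : K) ≠ 0 := by exact_mod_cast m.den_nz
  have : ((m.den : K) * δ) ^ 2 = algebraMap ℤ K (-(m.num * m.den)) := by
    rw [mul_pow, h.sq, ← hm]
    simp only [map_neg, map_mul, eq_intCast, Int.cast_natCast]
    field_simp
  exact ⟨⟨(m.den : K) * δ, IsIntegral.of_pow two_pos (this ▸ isIntegral_algebraMap)⟩, rfl⟩

/-- The ring of integers is relatively dense in the complex plane. -/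
theorem IsSqrtGen.exists_integer_near {m : ℚ} {δ : K} (h : IsSqrtGen m δ) (φ : K →+* ℂ) :
    ∃ κ : ℝ, 0 ≤ κ ∧ ∀ u : K, ∃ r : 𝓞 K, ‖φ (u - (r : K))‖ ≤ κ := by
  obtain ⟨θ, hθ⟩ := h.exists_integer_eq_den_mul
  refine ⟨1 / 2 + 1 / 2 * ‖φ θ‖, by positivity, fun u => ?_⟩
  obtain ⟨a, b, rfl⟩ := h.span u
  refine ⟨(round a : ℤ) + (round (b / m.den) : ℤ) * θ, ?_⟩
  have hd : (m.den : K) ≠ 0 := by exact_mod_cast m.den_nz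
  have h1 : (a : K) + b * δ - (((round a : ℤ) + (round (b / m.den) : ℤ) * θ : 𝓞 K) : K) =
      ((a - round a : ℚ) : K) + ((b / m.den - round (b / m.den) : ℚ) : K) * θ := by
    simp only [map_add, map_mul, map_intCast, hθ]
    push_cast
    field_simp
    ring
  rw [h1, map_add, map_mul, map_ratCast, map_ratCast]
  have hr : ∀ t : ℚ, ‖((t - round t : ℚ) : ℂ)‖ ≤ 1 / 2 := fun t => by
    have h2 := abs_sub_round t
    rw [Complex.norm_ratCast]
    have h3 : ((|t - round t| : ℚ) : ℝ) ≤ ((1 / 2 : ℚ) : ℝ) := by exact_mod_cast h2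
    simpa using h3
  refine (norm_add_le _ _).trans ?_
  rw [norm_mul]
  gcongr <;> exact hr _

theorem norm_inv_rat (z : K) : Algebra.norm ℚ z⁻¹ = (Algebra.norm ℚ z)⁻¹ := by
  by_cases hz : z = 0
  · simp [hz, Algebra.norm_zero]
  · refine eq_inv_of_mul_eq_one_left ?_
    rw [← map_mul, inv_mul_cancel₀ hz, map_one]

/-- The effect of one step `I ↦ J = z⁻¹ I C` of a Euclidean algorithm on `Nm (I⁻¹)`. -/
theorem absNorm_inv_of_eq {C : Ideal (𝓞 K)} {I J : FractionalIdeal (𝓞 K)⁰ K} {z : K}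
    (hJ : J = FractionalIdeal.spanSingleton (𝓞 K)⁰ z⁻¹ *
      (I * (C : FractionalIdeal (𝓞 K)⁰ K))) :
    FractionalIdeal.absNorm J⁻¹ =
      |Algebra.norm ℚ z| / Ideal.absNorm C * FractionalIdeal.absNorm I⁻¹ := by
  rw [map_inv₀, map_inv₀, hJ, map_mul, map_mul, FractionalIdeal.absNorm_span_singleton,
    FractionalIdeal.coeIdeal_absNorm, norm_inv_rat, abs_inv, mul_inv, mul_inv, inv_inv]
  ring

/-- If `C` has a Euclidean algorithm of any kind, then the distance of every `x₀ ∈ K` from the lattice `C` is at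
most the square root of `Nm C`. Otherwise, for every `I` with `Nm (I⁻¹)` large, the
lattice `I C` is so dense that it has a point near `x₀`; all steps from the coset of that point
increase `Nm (I⁻¹)` weakly, so one could descend forever in `ψ` through ideals of large norm. -/
theorem IsEuclideanAlgorithm.exists_norm_lt {C : Ideal (𝓞 K)} (hC : C ≠ ⊥)
    {ψ : OverIdeal (𝓞 K) K → ℕ} (hψ : IsEuclideanAlgorithm C ψ) {m : ℚ} {δ : K}
    (h : IsSqrtGen m δ) (x₀ : K) {ρ : ℚ} (hρ : (Ideal.absNorm C : ℚ) < ρ) :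
    ∃ y ∈ (C : FractionalIdeal (𝓞 K)⁰ K), Algebra.norm ℚ (x₀ + y) < ρ := by
  by_contra! hcon
  obtain ⟨φ, -, hφ⟩ := h.exists_embedding
  obtain ⟨κ, hκ, hnear⟩ := h.exists_integer_near φ
  obtain ⟨c, hc, hsmall⟩ := exists_small_mem_fractionalIdeal K
  have hN0 : 0 < Ideal.absNorm C := Nat.pos_of_ne_zero (by rwa [Ne, Ideal.absNorm_eq_zero_iff])
  have hN : (0 : ℝ) < Ideal.absNorm C := by exact_mod_cast hN0
  have hρ' : (Ideal.absNorm C : ℝ) < ρ := by exact_mod_cast hρ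
  set η : ℝ := Real.sqrt ρ - Real.sqrt (Ideal.absNorm C) with hη
  have hηpos : 0 < η := sub_pos.2 (Real.sqrt_lt_sqrt hN.le hρ')
  -- for `M ≤ Nm (I⁻¹)` the lattice `I C` has a point within `η` of every point of the plane
  obtain ⟨M, hM⟩ := exists_nat_gt (c * Ideal.absNorm C * κ ^ 2 / η ^ 2)
  have hMpos : (0 : ℝ) < M := lt_of_le_of_lt (by positivity) hM
  have hC' : (C : FractionalIdeal (𝓞 K)⁰ K) ≠ 0 := by simpa using hC
  -- for `I` with large `Nm I⁻¹` some coset only leads to even larger norms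
  have step : ∀ I : OverIdeal (𝓞 K) K, (M : ℚ) ≤ FractionalIdeal.absNorm (I.1⁻¹) →
      ∃ J : OverIdeal (𝓞 K) K, (M : ℚ) ≤ FractionalIdeal.absNorm (J.1⁻¹) ∧ ψ J < ψ I := by
    intro I hI
    have hI0 : I.1 ≠ 0 := by
      intro h0
      have := I.2
      rw [h0] at this
      exact one_ne_zero (le_antisymm this (FractionalIdeal.zero_le _))
    obtain ⟨β, hβ, hβ0, hβle⟩ := hsmall (I.1 * (C : FractionalIdeal (𝓞 K)⁰ K))
      (mul_ne_zero hI0 hC')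
    obtain ⟨r, hr⟩ := hnear (x₀ / β)
    set x : K := r * β with hx
    have hxmem : x ∈ I.1 * (C : FractionalIdeal (𝓞 K)⁰ K) := by
      have := Submodule.smul_mem
        ((I.1 * (C : FractionalIdeal (𝓞 K)⁰ K) : FractionalIdeal (𝓞 K)⁰ K) : Submodule (𝓞 K) K)
        r hβ
      rwa [Algebra.smul_def] at this
    have hdist : ‖φ (x₀ - x)‖ ≤ η := by
      have h1 : x₀ - x = (x₀ / β - r) * β := by rw [hx]; field_simp
      have hβn : ‖φ β‖ ^ 2 ≤ c * Ideal.absNorm C / M := by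
        rw [← hφ β]
        refine (le_abs_self _).trans (hβle.trans ?_)
        rw [map_mul, FractionalIdeal.coeIdeal_absNorm]
        rw [map_inv₀] at hI
        have hpos : (0 : ℚ) < FractionalIdeal.absNorm I.1 :=
          lt_of_le_of_ne (FractionalIdeal.absNorm_nonneg _)
            (fun h0 => hI0 (FractionalIdeal.absNorm_eq_zero_iff.1 h0.symm))
        have hI' : (M : ℝ) ≤ ((FractionalIdeal.absNorm I.1 : ℚ) : ℝ)⁻¹ := by exact_mod_cast hI
        have hpos' : (0 : ℝ) < (FractionalIdeal.absNorm I.1 : ℚ) := by exact_mod_cast hpos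
        have h2 := (le_inv_comm₀ hMpos hpos').1 hI'
        push_cast
        calc c * ((FractionalIdeal.absNorm I.1 : ℚ) * (Ideal.absNorm C : ℝ))
            ≤ c * ((M : ℝ)⁻¹ * Ideal.absNorm C) := by gcongr
          _ = _ := by ring
      have h3 : ‖φ (x₀ - x)‖ ^ 2 ≤ η ^ 2 := by
        rw [h1, map_mul, norm_mul, mul_pow]
        calc ‖φ (x₀ / β - r)‖ ^ 2 * ‖φ β‖ ^ 2 ≤ κ ^ 2 * (c * Ideal.absNorm C / M) := by gcongr
          _ ≤ η ^ 2 := by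
            rw [div_lt_iff₀ (by positivity)] at hM
            rw [← mul_div_assoc, div_le_iff₀ hMpos]
            linarith
      exact abs_le_of_sq_le_sq' h3 hηpos.le |>.2
    have hfar : ∀ y ∈ (C : FractionalIdeal (𝓞 K)⁰ K),
        (Ideal.absNorm C : ℚ) ≤ Algebra.norm ℚ (x + y) := by
      intro y hy
      have h1 : Real.sqrt ρ ≤ ‖φ (x₀ + y)‖ := by
        refine Real.sqrt_le_iff.2 ⟨norm_nonneg _, ?_⟩
        rw [← hφ]
        exact_mod_cast hcon y hy
      have h2 : ‖φ (x₀ + y)‖ ≤ ‖φ (x₀ - x)‖ + ‖φ (x + y)‖ := by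
        rw [show x₀ + y = (x₀ - x) + (x + y) by ring, map_add]
        exact norm_add_le _ _
      have h3 : Real.sqrt (Ideal.absNorm C) ≤ ‖φ (x + y)‖ := by linarith
      have h4 := (Real.sqrt_le_iff.1 h3).2
      rw [← hφ] at h4
      exact_mod_cast h4
    have hxC : x ∉ (C : FractionalIdeal (𝓞 K)⁰ K) := by
      intro hxC
      have := hfar (-x) (neg_mem (S := Submodule (𝓞 K) K) hxC)
      rw [add_neg_cancel, Algebra.norm_zero] at this
      have : Ideal.absNorm C ≤ 0 := by exact_mod_cast this
      omega
    obtain ⟨y, hy, J, hJ, hlt⟩ := hψ I x hxmem hxC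
    refine ⟨J, hI.trans ?_, hlt⟩
    rw [absNorm_inv_of_eq hJ]
    refine le_mul_of_one_le_left (FractionalIdeal.absNorm_nonneg _) ?_
    rw [one_le_div (by exact_mod_cast hN0)]
    exact (hfar y hy).trans (le_abs_self _)
  have desc : ∀ (n : ℕ) (I : OverIdeal (𝓞 K) K), (M : ℚ) ≤ FractionalIdeal.absNorm (I.1⁻¹) →
      ψ I = n → False := by
    intro n
    induction n using Nat.strong_induction_on with
    | _ n ih =>
      intro I hI hn
      obtain ⟨J, hJ, hlt⟩ := step I hI
      exact ih (ψ J) (hn ▸ hlt) J hJ rfl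
  have hM0 : 0 < M := by exact_mod_cast hMpos
  have hM0K : (M : K) ≠ 0 := by exact_mod_cast hM0.ne'
  refine desc _ ⟨FractionalIdeal.spanSingleton (𝓞 K)⁰ (M : K)⁻¹, ?_⟩ ?_ rfl
  · rw [FractionalIdeal.one_le, FractionalIdeal.mem_spanSingleton]
    exact ⟨(M : 𝓞 K), by rw [Algebra.smul_def]; simp [hM0K]⟩
  · rw [map_inv₀, FractionalIdeal.absNorm_span_singleton, norm_inv_rat, abs_inv, inv_inv]
    have := h.norm_eq M 0
    simp only [Rat.cast_natCast, Rat.cast_zero, zero_mul, add_zero] at this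
    rw [this]
    have h1 : (1 : ℚ) ≤ M := by exact_mod_cast hM0
    rw [zero_pow two_ne_zero, mul_zero, add_zero, abs_of_nonneg (by positivity)]
    nlinarith

/-! ### Reduced bases and circumradii -/

/-- For a reduced form `(a, b, c)` this is the difference of the squared distances from the circumcentre
of the triangle `0, z, w` to the lattice point `i z + j w` and to the origin: the circumcentre has no
lattice point closer than the vertices of the triangle. -/
theorem reduced_form_shift_nonneg {a b c : ℤ} (hb : 0 ≤ b) (hba : b ≤ a) (hac : a ≤ c) (i j : ℤ) :
    0 ≤ a * (i * (i - 1)) + b * (i * j) + c * (j * (j - 1)) := by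
  have hsq : ∀ k : ℤ, 0 ≤ k * (k - 1) := fun k => by
    rcases le_or_gt k 0 with hk | hk
    · exact mul_nonneg_of_nonpos_of_nonpos hk (by omega)
    · exact mul_nonneg (by omega) (by omega)
  have hi := hsq i
  have hj := hsq j
  have hij := hsq (i + j)
  have h1 : 0 ≤ (a - b) * (i * (i - 1)) := mul_nonneg (by omega) hi
  have h2 : 0 ≤ (c - b) * (j * (j - 1)) := mul_nonneg (by omega) hj
  rcases le_or_gt 0 (i * j) with h | h
  · have h3 := mul_nonneg hb h
    have h4 := mul_nonneg hb hi
    have h5 := mul_nonneg hb hj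
    linarith
  · have h3 : 0 ≤ b * ((i + j) * (i + j - 1) - i * j) := mul_nonneg hb (by linarith)
    linarith

/-- The hypothesis `hR` says that the squared circumradius `a c (a + c - b) / (4 a c - b ^ 2)` of the
reduced triangle is at most `1`. It forces `c ≤ 3`, which leaves finitely many discriminants. No
primitivity of the form is needed: `-12`, `-16` and `-27` only contribute the fields of `-3`, `-4`. -/
theorem exists_listed_of_circumradius_le {a b c : ℤ} (ha : 0 < a) (hb : 0 ≤ b) (hba : b ≤ a)
    (hac : a ≤ c) (hR : a * c * (a + c - b) ≤ 4 * a * c - b ^ 2) :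
    ∃ D : ℕ, D ∈ ({1, 2, 3, 7, 11, 5, 15} : Set ℕ) ∧
      ∃ t : ℚ, t ≠ 0 ∧ t ^ 2 * ((4 * a * c - b ^ 2 : ℤ) : ℚ) = D := by
  have hac0 : 0 < a * c := mul_pos ha (by omega)
  have hc : c ≤ 3 := by
    by_contra! hc
    have h1 : 0 ≤ a * c * (a + c - b - 4) := mul_nonneg hac0.le (by omega)
    have hb2 : b ^ 2 ≤ 0 := by linarith
    have hb0 : b = 0 := by nlinarith
    subst hb0
    nlinarith
  have ha3 : a ≤ 3 := by omega
  have hb3 : b ≤ 3 := by omega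
  have hΔ : 4 * a * c - b ^ 2 = 3 ∨ 4 * a * c - b ^ 2 = 4 ∨ 4 * a * c - b ^ 2 = 7 ∨
      4 * a * c - b ^ 2 = 8 ∨ 4 * a * c - b ^ 2 = 11 ∨ 4 * a * c - b ^ 2 = 12 ∨
      4 * a * c - b ^ 2 = 15 ∨ 4 * a * c - b ^ 2 = 16 ∨ 4 * a * c - b ^ 2 = 20 ∨
      4 * a * c - b ^ 2 = 27 := by
    interval_cases a <;> interval_cases c <;> interval_cases b <;> omega
  rcases hΔ with h | h | h | h | h | h | h | h | h | h <;> rw [h]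
  · exact ⟨3, by simp, 1, by norm_num, by norm_num⟩
  · exact ⟨1, by simp, 1 / 2, by norm_num, by norm_num⟩
  · exact ⟨7, by simp, 1, by norm_num, by norm_num⟩
  · exact ⟨2, by simp, 1 / 2, by norm_num, by norm_num⟩
  · exact ⟨11, by simp, 1, by norm_num, by norm_num⟩
  · exact ⟨3, by simp, 1 / 2, by norm_num, by norm_num⟩
  · exact ⟨15, by simp, 1, by norm_num, by norm_num⟩
  · exact ⟨1, by simp, 1 / 4, by norm_num, by norm_num⟩
  · exact ⟨5, by simp, 1 / 2, by norm_num, by norm_num⟩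
  · exact ⟨3, by simp, 1 / 3, by norm_num, by norm_num⟩

theorem exists_forall_le_of_nat {α : Type*} (P : α → Prop) (g : α → ℕ) (h : ∃ x, P x) :
    ∃ x, P x ∧ ∀ y, P y → g x ≤ g y := by
  obtain ⟨x, hx, hmin⟩ := (measure g).wf.has_min {x | P x} h
  exact ⟨x, hx, fun y hy => not_lt.1 (hmin y hy)⟩

/-- The norm as a binary quadratic form on the span of `z` and `w`. -/
theorem IsSqrtGen.norm_comb {m : ℚ} {δ : K} (h : IsSqrtGen m δ) (z w : K) (p r : ℚ) :
    Algebra.norm ℚ (p * z + r * w) = p ^ 2 * Algebra.norm ℚ z +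
      p * r * (Algebra.norm ℚ (z + w) - Algebra.norm ℚ z - Algebra.norm ℚ w) +
      r ^ 2 * Algebra.norm ℚ w := by
  obtain ⟨a, b, rfl⟩ := h.span z
  obtain ⟨c, d, rfl⟩ := h.span w
  have h1 : (p : K) * (a + b * δ) + r * (c + d * δ) =
      ((p * a + r * c : ℚ) : K) + ((p * b + r * d : ℚ) : K) * δ := by push_cast; ring
  have h2 : (a + b * δ) + (c + d * δ) = ((a + c : ℚ) : K) + ((b + d : ℚ) : K) * δ := by
    push_cast; ring
  rw [h1, h2, h.norm_eq, h.norm_eq, h.norm_eq, h.norm_eq]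
  ring

theorem IsSqrtGen.norm_pos {m : ℚ} {δ : K} (h : IsSqrtGen m δ) {x : K} (hx : x ≠ 0) :
    0 < Algebra.norm ℚ x :=
  lt_of_le_of_ne (h.norm_nonneg x) (Ne.symm (Algebra.norm_ne_zero_iff.2 hx))

/-- Lagrange–Gauss reduction of the norm form on the lattice `C`, normalized by `Nm C`, which divides all
its values. Only the spanning of `C` by `z` and `w` over `ℤ` is recorded, together with the fact that
`w` is not a rational multiple of `z`. -/
theorem IsSqrtGen.exists_reduced_basis {m : ℚ} {δ : K} (h : IsSqrtGen m δ) {C : Ideal (𝓞 K)}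
    (hC : C ≠ ⊥) :
    ∃ z ∈ C, ∃ w ∈ C, ∃ a b c : ℤ, z ≠ 0 ∧ 0 < a ∧ 0 ≤ b ∧ b ≤ a ∧ a ≤ c ∧
      (∀ s : ℚ, (w : K) ≠ s * z) ∧
      (∀ p r : ℚ, Algebra.norm ℚ ((p : K) * z + r * w) =
        Ideal.absNorm C * (a * p ^ 2 + b * (p * r) + c * r ^ 2)) ∧
      ∀ y ∈ C, ∃ i j : ℤ, (y : K) = i * z + j * w := by
  have hN0 : 0 < Ideal.absNorm C := Nat.pos_of_ne_zero (by rwa [Ne, Ideal.absNorm_eq_zero_iff])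
  have hN : (0 : ℚ) < Ideal.absNorm C := by exact_mod_cast hN0
  let g : 𝓞 K → ℕ := fun y => (Algebra.norm ℤ y).natAbs
  have hg : ∀ y : 𝓞 K, (g y : ℚ) = Algebra.norm ℚ (y : K) := fun y => by
    have h1 : ((Algebra.norm ℤ y : ℤ) : ℚ) = Algebra.norm ℚ (y : K) :=
      Algebra.coe_norm_int y
    have h2 : (0 : ℤ) ≤ Algebra.norm ℤ y := by
      have := h.norm_nonneg (y : K); rw [← h1] at this; exact_mod_cast this
    rw [← h1, ← Int.natAbs_of_nonneg h2, Int.cast_natCast]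
  have hdvd : ∀ y ∈ C, ∃ k : ℤ, Algebra.norm ℚ (y : K) = Ideal.absNorm C * k := fun y hy => by
    obtain ⟨k, hk⟩ := Ideal.absNorm_dvd_norm_of_mem hy
    refine ⟨k, ?_⟩
    rw [← Algebra.coe_norm_int y, hk]
    push_cast; rfl
  -- a shortest nonzero vector
  obtain ⟨z, ⟨hzC, hz0⟩, hzmin⟩ := exists_forall_le_of_nat (fun y => y ∈ C ∧ y ≠ 0) g
    (Submodule.exists_mem_ne_zero_of_ne_bot hC)
  have hz0' : (z : K) ≠ 0 := by simpa using hz0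
  -- a shortest vector off the line of `z`
  obtain ⟨w₀, ⟨hwC₀, hind₀⟩, hwmin₀⟩ :=
    exists_forall_le_of_nat (fun y => y ∈ C ∧ ∀ s : ℚ, (y : K) ≠ s * z) g (by
      obtain ⟨θ, hθ⟩ := h.exists_integer_eq_den_mul
      refine ⟨θ * z, C.mul_mem_left θ hzC, fun s hs => ?_⟩
      have h1 : ((0 : ℚ) : K) + (m.den : ℚ) * δ = s + (0 : ℚ) * δ := by
        have h2 : algebraMap (𝓞 K) K θ = s := mul_right_cancel₀ hz0' (by rw [← hs]; simp)
        rw [hθ] at h2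
        push_cast
        linear_combination h2
      have := (h.rat_ext h1).2
      have hd : (m.den : ℚ) ≠ 0 := by exact_mod_cast m.den_nz
      exact hd this)
  -- changing the sign of that vector makes the middle coefficient nonnegative
  obtain ⟨w, hwC, hind, hwmin, hT⟩ : ∃ w ∈ C, (∀ s : ℚ, (w : K) ≠ s * z) ∧
      (∀ y ∈ C, (∀ s : ℚ, (y : K) ≠ s * z) →
        Algebra.norm ℚ (w : K) ≤ Algebra.norm ℚ (y : K)) ∧
      0 ≤ Algebra.norm ℚ ((z : K) + w) - Algebra.norm ℚ (z : K) - Algebra.norm ℚ (w : K) := by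
    have hmin : ∀ y ∈ C, (∀ s : ℚ, (y : K) ≠ s * z) →
        Algebra.norm ℚ (w₀ : K) ≤ Algebra.norm ℚ (y : K) := fun y hy hy' => by
      rw [← hg, ← hg]
      exact_mod_cast hwmin₀ y ⟨hy, hy'⟩
    rcases le_total 0 (Algebra.norm ℚ ((z : K) + w₀) - Algebra.norm ℚ (z : K) -
        Algebra.norm ℚ (w₀ : K)) with hT | hT
    · exact ⟨w₀, hwC₀, hind₀, hmin, hT⟩
    · have hneg : Algebra.norm ℚ (-(w₀ : K)) = Algebra.norm ℚ (w₀ : K) := by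
        have := h.norm_comb (z : K) w₀ 0 (-1)
        simpa using this
      refine ⟨-w₀, neg_mem hwC₀, fun s hs => hind₀ (-s) ?_, fun y hy hy' => ?_, ?_⟩
      · push_cast at hs ⊢
        linear_combination -hs
      · push_cast
        rw [hneg]
        exact hmin y hy hy'
      · have := h.norm_comb (z : K) w₀ 1 (-1)
        simp only [Rat.cast_one, one_mul, Rat.cast_neg, neg_mul] at this
        push_cast
        rw [this, hneg]
        linarith
  obtain ⟨a, ha⟩ := hdvd z hzC
  obtain ⟨c, hc⟩ := hdvd w hwC
  obtain ⟨e, he⟩ := hdvd (z + w) (add_mem hzC hwC)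
  push_cast at he
  have hw0 : w ≠ 0 := by
    rintro rfl
    exact hind 0 (by simp)
  have hzpos := h.norm_pos hz0'
  have hcomb := h.norm_comb (z : K) w
  -- minimality of `w` bounds the middle coefficient
  have hTle : Algebra.norm ℚ ((z : K) + w) - Algebra.norm ℚ (z : K) - Algebra.norm ℚ (w : K) ≤
      Algebra.norm ℚ (z : K) := by
    have h1 := hwmin (w - z) (sub_mem hwC hzC) (fun s hs => hind (s + 1) (by
      push_cast at hs ⊢; linear_combination hs))
    have h2 := hcomb (-1) 1
    have h3 : ((w - z : 𝓞 K) : K) = ((-1 : ℚ) : K) * z + (1 : ℚ) * w := by push_cast; ring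
    rw [h3, h2] at h1
    linarith
  have hzw : Algebra.norm ℚ (z : K) ≤ Algebra.norm ℚ (w : K) := by
    rw [← hg, ← hg]
    exact_mod_cast hzmin w ⟨hwC, hw0⟩
  set A := Algebra.norm ℚ (z : K) with hA
  set W := Algebra.norm ℚ (w : K) with hW
  set T := Algebra.norm ℚ ((z : K) + w) - A - W with hTdef
  have hTe : T = Ideal.absNorm C * ((e - a - c : ℤ) : ℚ) := by
    rw [hTdef, he, ha, hc]; push_cast; ring
  have cancel : ∀ {x y : ℤ}, (Ideal.absNorm C : ℚ) * x ≤ Ideal.absNorm C * y → x ≤ y :=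
    fun hxy => by exact_mod_cast le_of_mul_le_mul_left hxy hN
  refine ⟨z, hzC, w, hwC, a, e - a - c, c, hz0, ?_, ?_, ?_, ?_, hind, ?_, ?_⟩
  · rw [ha] at hzpos
    exact_mod_cast (pos_iff_pos_of_mul_pos hzpos).1 hN
  · exact cancel (by rw [← hTe]; simpa using hT)
  · exact cancel (by rw [← hTe, ← ha]; exact hTle)
  · exact cancel (by rw [← ha, ← hc]; exact hzw)
  · intro p r
    rw [hcomb, hTe, ha, hc]
    ring
  · intro y hy
    -- subtract the nearest lattice point; the remainder is too short to be nonzero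
    have hirr : ∀ s : ℚ, (w : K) / z ≠ s := fun s hs => hind s (by rw [← hs]; field_simp)
    obtain ⟨p, r, hpr⟩ := exists_rat_add_rat_mul h.finrank_eq_two hirr ((y : K) / z)
    have hy1 : (y : K) = p * z + r * w := by
      field_simp at hpr
      linear_combination hpr
    set p' := p - round p with hp'
    set r' := r - round r with hr'
    have hp2 : |p'| ≤ 1 / 2 := abs_sub_round p
    have hr2 : |r'| ≤ 1 / 2 := abs_sub_round r
    set y' : 𝓞 K := y - ((round p : ℤ) * z + (round r : ℤ) * w) with hy'
    have hy'C : y' ∈ C := sub_mem hy (add_mem (C.mul_mem_left _ hzC) (C.mul_mem_left _ hwC))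
    have hcoe : (y' : K) = (y : K) - ((round p : ℤ) * z + (round r : ℤ) * w) := by
      rw [hy']
      simp only [map_sub, map_add, map_mul, map_intCast]
    have hy'K : (y' : K) = p' * z + r' * w := by
      rw [hcoe, hy1, hp', hr']
      push_cast
      ring
    have hp4 : p' ^ 2 ≤ 1 / 4 := by
      have := sq_le_sq' (abs_le.1 hp2).1 (abs_le.1 hp2).2; linarith
    have hr4 : r' ^ 2 ≤ 1 / 4 := by
      have := sq_le_sq' (abs_le.1 hr2).1 (abs_le.1 hr2).2; linarith
    have hpr4 : p' * r' ≤ 1 / 4 := by nlinarith [sq_nonneg (p' - r')]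
    have hny := hcomb p' r'
    rw [← hy'K] at hny
    have hr0 : r' = 0 := by
      by_contra hr0
      have hr0' : (r' : K) ≠ 0 := by exact_mod_cast hr0
      have := hwmin y' hy'C (fun s hs => hind ((s - p') / r') (by
        rw [hy'K] at hs
        push_cast
        field_simp
        linear_combination hs))
      nlinarith
    have hp0 : p' = 0 := by
      by_contra hp0
      have hp0' : (p' : K) ≠ 0 := by exact_mod_cast hp0
      have hy0 : y' ≠ 0 := by
        intro h0
        rw [h0, hr0] at hy'K
        simp at hy'K
        tauto
      have h1 : A ≤ Algebra.norm ℚ (y' : K) := by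
        rw [hA, ← hg, ← hg]
        exact_mod_cast hzmin y' ⟨hy'C, hy0⟩
      rw [hny, hr0] at h1
      nlinarith
    refine ⟨round p, round r, ?_⟩
    rw [hp0, hr0, hcoe] at hy'K
    linear_combination hy'K

/-- A Euclidean ideal bounds the circumradius of its own reduced triangle, hence the field is listed. -/
theorem IsEuclidean.exists_isSqrtGen (hK : IsImaginaryQuadratic K) {C : Ideal (𝓞 K)}
    (hC : IsEuclidean K C) :
    ∃ D : ℕ, D ∈ ({1, 2, 3, 7, 11, 5, 15} : Set ℕ) ∧ ∃ δ : K, IsSqrtGen (D : ℚ) δ := by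
  obtain ⟨hC0, ψ, hψ⟩ := hC
  obtain ⟨m, δ, h⟩ := hK.exists_isSqrtGen
  obtain ⟨z, hz, w, hw, a, b, c, hz0, ha, hb, hba, hac, hind, hnorm, hbasis⟩ :=
    h.exists_reduced_basis hC0
  have hN0 : 0 < Ideal.absNorm C := Nat.pos_of_ne_zero (by rwa [Ne, Ideal.absNorm_eq_zero_iff])
  have hN : (0 : ℚ) < Ideal.absNorm C := by exact_mod_cast hN0
  have hΔ : (0 : ℚ) < 4 * a * c - b ^ 2 := by
    have : 0 < 4 * a * c - b ^ 2 := by nlinarith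
    exact_mod_cast this
  -- the circumradius of the triangle `0, z, w` is at most `1`
  have hR : a * c * (a + c - b) ≤ 4 * a * c - b ^ 2 := by
    by_contra! hR
    have hR' : (4 * a * c - b ^ 2 : ℚ) < a * c * (a + c - b) := by exact_mod_cast hR
    -- `s z + t w` is the circumcentre; its negative is used because the algorithm adds elements of `C`
    set s : ℚ := (2 * a * c - b * c) / (4 * a * c - b ^ 2) with hs
    set t : ℚ := (2 * a * c - a * b) / (4 * a * c - b ^ 2) with ht
    have hρ : (Ideal.absNorm C : ℚ) <
        Ideal.absNorm C * (a * c * (a + c - b) / (4 * a * c - b ^ 2)) :=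
      lt_mul_of_one_lt_right hN ((one_lt_div hΔ).2 hR')
    obtain ⟨y, hy, hlt⟩ := hψ.exists_norm_lt hC0 h (-(s * z + t * w)) hρ
    rw [FractionalIdeal.mem_coeIdeal] at hy
    obtain ⟨y, hy, rfl⟩ := hy
    obtain ⟨i, j, hij⟩ := hbasis y hy
    have h1 : -((s : K) * z + t * w) + algebraMap (𝓞 K) K y =
        ((i - s : ℚ) : K) * z + ((j - t : ℚ) : K) * w := by
      have hij' : algebraMap (𝓞 K) K y = i * z + j * w := hij
      rw [hij']; push_cast; ring
    rw [h1, hnorm] at hlt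
    have h2 := lt_of_mul_lt_mul_left hlt hN.le
    have h3 : (a * (i - s) ^ 2 + b * ((i - s) * (j - t)) + c * (j - t) ^ 2 : ℚ) =
        a * c * (a + c - b) / (4 * a * c - b ^ 2) +
          (a * (i * (i - 1)) + b * (i * j) + c * (j * (j - 1))) := by
      have key : ∀ Δ : ℚ, Δ ≠ 0 → Δ = 4 * a * c - b ^ 2 →
          a * (i - (2 * a * c - b * c) / Δ) ^ 2 +
            b * ((i - (2 * a * c - b * c) / Δ) * (j - (2 * a * c - a * b) / Δ)) +
            c * (j - (2 * a * c - a * b) / Δ) ^ 2 =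
          a * c * (a + c - b) / Δ +
            (a * (i * (i - 1)) + b * (i * j) + c * (j * (j - 1)) : ℚ) := by
        intro Δ h0 hΔ'
        field_simp
        rw [hΔ']
        ring
      exact key _ hΔ.ne' rfl
    have h4 : (0 : ℚ) ≤ a * (i * (i - 1)) + b * (i * j) + c * (j * (j - 1)) := by
      exact_mod_cast reduced_form_shift_nonneg hb hba hac i j
    rw [h3] at h2
    linarith
  obtain ⟨D, hD, t, ht, htD⟩ := exists_listed_of_circumradius_le ha hb hba hac hR
  refine ⟨D, hD, ?_⟩
  have hz0' : (z : K) ≠ 0 := by simpa using hz0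
  obtain ⟨p, q, hpq⟩ := h.span ((w : K) / z)
  have hq : q ≠ 0 := by
    rintro rfl
    exact hind p (by field_simp at hpq; rw [hpq]; simp [mul_comm])
  have ha' : (a : ℚ) ≠ 0 := by exact_mod_cast ha.ne'
  have hnz := hnorm 1 0
  have hnw : ∀ r : ℚ, Algebra.norm ℚ ((r : K) + w / z) * a = a * r ^ 2 + b * r + c := fun r => by
    have h1 := hnorm r 1
    have h2 : ((r : ℚ) : K) * z + (1 : ℚ) * w = (r + w / z) * z := by
      push_cast; field_simp
    rw [h2, map_mul] at h1
    simp only [Rat.cast_one, Rat.cast_zero, one_mul, zero_mul, add_zero] at hnz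
    rw [hnz] at h1
    have := hN.ne'
    refine mul_left_cancel₀ this ?_
    linear_combination h1
  have h0 := hnw 0
  have h1 := hnw 1
  have e : ∀ r : ℚ, (r : K) + w / z = ((r + p : ℚ) : K) + q * δ := fun r => by
    rw [hpq]; push_cast; ring
  rw [e, h.norm_eq] at h0 h1
  have h2p : 2 * p * a = b := by linear_combination h1 - h0
  have hm : (2 * a * q) ^ 2 * m = 4 * a * c - b ^ 2 := by
    rw [← h2p]; linear_combination (4 * (a : ℚ)) * h0
  have := h.scale (t := t * (2 * a * q)) (by positivity)
  rw [mul_pow, mul_assoc, hm] at this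
  push_cast at htD
  rw [htD] at this
  exact ⟨_, this⟩

/-! ### Covering lattices, norm-Euclidean ideals and the class group -/

/-- The translates by `C` of the open disc of squared radius `Nm C` cover `K`. The sign of the
translation is that of the definition of a Euclidean algorithm. -/
def IsNormCovering (C : Ideal (𝓞 K)) : Prop :=
  ∀ x : K, ∃ y ∈ C, |Algebra.norm ℚ (x + (y : K))| < Ideal.absNorm C

theorem OverIdeal.ne_zero (I : OverIdeal (𝓞 K) K) : I.1 ≠ 0 := by
  intro h0
  have := I.2
  rw [h0] at this
  exact one_ne_zero (le_antisymm this (FractionalIdeal.zero_le _))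

/-- The inverse of a fractional ideal containing `1` is an integral ideal, so its norm is a natural
number. -/
theorem OverIdeal.exists_natCast_eq_absNorm_inv (I : OverIdeal (𝓞 K) K) :
    ∃ n : ℕ, (n : ℚ) = FractionalIdeal.absNorm (I.1⁻¹) := by
  have h1 : I.1⁻¹ ≤ 1 := by
    have := mul_le_mul_right I.2 I.1⁻¹
    rwa [mul_one, inv_mul_cancel₀ I.ne_zero] at this
  obtain ⟨J, hJ⟩ := FractionalIdeal.le_one_iff_exists_coeIdeal.1 h1
  exact ⟨Ideal.absNorm J, by rw [← hJ, FractionalIdeal.coeIdeal_absNorm]⟩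

theorem coeIdeal_le_mul (I : OverIdeal (𝓞 K) K) (C : Ideal (𝓞 K)) :
    (C : FractionalIdeal (𝓞 K)⁰ K) ≤ I.1 * C := by
  have := mul_le_mul_left I.2 (C : FractionalIdeal (𝓞 K)⁰ K)
  rwa [one_mul] at this

theorem IsNormCovering.ne_bot {C : Ideal (𝓞 K)} (h : IsNormCovering C) : C ≠ ⊥ := by
  rintro rfl
  obtain ⟨y, -, hy⟩ := h 0
  rw [Ideal.absNorm_bot, Nat.cast_zero] at hy
  exact absurd hy (not_lt.2 (abs_nonneg _))

/-- The step `z⁻¹ I C` multiplies `Nm (I⁻¹)` by `|Nm z| / Nm C`, which the covering property makes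
smaller than `1`. -/
theorem IsNormCovering.isNormEuclidean {C : Ideal (𝓞 K)} (h : IsNormCovering C) :
    IsNormEuclidean C := by
  have hN : (0 : ℚ) < Ideal.absNorm C := by
    exact_mod_cast Nat.pos_of_ne_zero (by rw [Ne, Ideal.absNorm_eq_zero_iff]; exact h.ne_bot)
  choose ψ hψ using OverIdeal.exists_natCast_eq_absNorm_inv (K := K)
  refine ⟨h.ne_bot, ψ, hψ, fun I x hx hxC => ?_⟩
  obtain ⟨y, hy, hlt⟩ := h x
  have hyC : (y : K) ∈ (C : FractionalIdeal (𝓞 K)⁰ K) := FractionalIdeal.mem_coeIdeal_of_mem _ hy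
  have hz : x + y ≠ 0 := fun h0 => hxC (by
    rw [eq_neg_of_add_eq_zero_left h0]
    exact neg_mem (S := Submodule (𝓞 K) K) hyC)
  have hmem : x + y ∈ I.1 * (C : FractionalIdeal (𝓞 K)⁰ K) :=
    Submodule.add_mem _ hx (coeIdeal_le_mul I C hyC)
  refine ⟨y, hyC, ⟨FractionalIdeal.spanSingleton (𝓞 K)⁰ (x + y)⁻¹ *
    (I.1 * (C : FractionalIdeal (𝓞 K)⁰ K)), ?_⟩, rfl, ?_⟩
  · rw [FractionalIdeal.one_le, FractionalIdeal.mem_singleton_mul]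
    exact ⟨x + y, hmem, (inv_mul_cancel₀ hz).symm⟩
  · have hpos : (0 : ℚ) < FractionalIdeal.absNorm I.1⁻¹ :=
      lt_of_le_of_ne (FractionalIdeal.absNorm_nonneg _)
        (fun h0 => inv_ne_zero I.ne_zero (FractionalIdeal.absNorm_eq_zero_iff.1 h0.symm))
    rw [← Nat.cast_lt (α := ℚ), hψ, hψ, absNorm_inv_of_eq rfl]
    exact mul_lt_of_lt_one_left hpos ((div_lt_one hN).2 hlt)

theorem IsNormEuclidean.isEuclidean {C : Ideal (𝓞 K)} (h : IsNormEuclidean C) :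
    IsEuclidean K C := by
  obtain ⟨h0, ψ, -, hψ⟩ := h
  exact ⟨h0, ψ, hψ⟩

theorem abs_norm_coe (a : 𝓞 K) :
    |Algebra.norm ℚ (a : K)| = Ideal.absNorm (Ideal.span {a}) := by
  rw [Ideal.absNorm_span_singleton, ← Algebra.coe_norm_int, Nat.cast_natAbs, Int.cast_abs]

/-- Ideals of one class are homothetic lattices, and the covering property is homothety invariant. -/
theorem IsNormCovering.of_mk0_eq {C C' : (Ideal (𝓞 K))⁰}
    (hCC' : ClassGroup.mk0 C = ClassGroup.mk0 C') (h : IsNormCovering (C : Ideal (𝓞 K))) :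
    IsNormCovering (C' : Ideal (𝓞 K)) := by
  obtain ⟨a, b, ha, hb, hab⟩ := ClassGroup.mk0_eq_mk0_iff.1 hCC'
  have ha' : (a : K) ≠ 0 := by simpa using ha
  have hb' : (b : K) ≠ 0 := by simpa using hb
  have hN := congrArg (fun I => (Ideal.absNorm I : ℚ)) hab
  simp only [map_mul, Nat.cast_mul] at hN
  rw [← abs_norm_coe, ← abs_norm_coe] at hN
  intro x
  obtain ⟨y, hy, hlt⟩ := h (x * b / a)
  have hmem : a * y ∈ Ideal.span {b} * (C' : Ideal (𝓞 K)) := by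
    rw [← hab]
    exact Ideal.mul_mem_mul (Ideal.mem_span_singleton_self a) hy
  obtain ⟨y', hy', hyy'⟩ := Ideal.mem_span_singleton_mul.1 hmem
  refine ⟨y', hy', ?_⟩
  have h1 : (b : K) * y' = a * y := by
    have := congrArg (fun t : 𝓞 K => (t : K)) hyy'
    simpa using this
  have h2 : (b : K) * (x + y') = a * (x * b / a + y) := by
    rw [mul_add, h1]; field_simp
  have h3 := congrArg (fun t => |Algebra.norm ℚ t|) h2
  simp only [map_mul, abs_mul] at h3
  have hna : 0 < |Algebra.norm ℚ (a : K)| := abs_pos.2 (Algebra.norm_ne_zero_iff.2 ha')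
  have hnb : 0 < |Algebra.norm ℚ (b : K)| := abs_pos.2 (Algebra.norm_ne_zero_iff.2 hb')
  refine lt_of_mul_lt_mul_left ?_ hnb.le
  rw [h3, ← hN]
  exact mul_lt_mul_of_pos_left hlt hna

/-- A Euclidean ideal generates the class group: a step of the algorithm multiplies the class of `I` by
that of `C`, and the algorithm only stops at the unit ideal. -/
theorem IsEuclidean.generatesClassGroup {C : (Ideal (𝓞 K))⁰}
    (h : IsEuclidean K (C : Ideal (𝓞 K))) : GeneratesClassGroup (ClassGroup.mk0 C) := by
  obtain ⟨hC, ψ, hψ⟩ := h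
  have key : ∀ (n : ℕ) (I : OverIdeal (𝓞 K) K), ψ I = n →
      ClassGroup.mk K (Units.mk0 I.1 I.ne_zero) ∈ Subgroup.zpowers (ClassGroup.mk0 C) := by
    intro n
    induction n using Nat.strong_induction_on with
    | _ n ih =>
      intro I hn
      by_cases hI : I.1 * ((C : Ideal (𝓞 K)) : FractionalIdeal (𝓞 K)⁰ K) ≤
          ((C : Ideal (𝓞 K)) : FractionalIdeal (𝓞 K)⁰ K)
      · have h1 : I.1 = 1 := by
          have h2 := le_antisymm hI (coeIdeal_le_mul I C)
          have hC' : ((C : Ideal (𝓞 K)) : FractionalIdeal (𝓞 K)⁰ K) ≠ 0 := by simpa using hC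
          exact mul_right_cancel₀ hC' (by rw [h2, one_mul])
        have h2 : Units.mk0 I.1 I.ne_zero = 1 := Units.ext h1
        rw [h2, map_one]
        exact one_mem _
      · obtain ⟨x, hx, hxC⟩ := SetLike.not_le_iff_exists.1 hI
        obtain ⟨y, hy, J, hJ, hlt⟩ := hψ I x hx hxC
        have hJmem := ih _ (hn ▸ hlt) J rfl
        have hs : FractionalIdeal.spanSingleton (𝓞 K)⁰ (x + y)⁻¹ ≠ 0 := by
          intro h0
          exact J.ne_zero (by rw [hJ, h0, zero_mul])
        have h1 : Units.mk0 J.1 J.ne_zero = Units.mk0 _ hs *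
            (Units.mk0 I.1 I.ne_zero * FractionalIdeal.mk0 K C) := Units.ext hJ
        have h2 : ClassGroup.mk K (Units.mk0 _ hs) = 1 :=
          ClassGroup.mk_eq_one_iff.2 ⟨⟨(x + y)⁻¹, FractionalIdeal.coe_spanSingleton _ _⟩⟩
        rw [h1, map_mul, map_mul, h2, one_mul, ClassGroup.mk_mk0] at hJmem
        exact (Subgroup.mul_mem_cancel_right _ (Subgroup.mem_zpowers _)).1 hJmem
  rw [GeneratesClassGroup, eq_top_iff]
  rintro g -
  obtain ⟨J, rfl⟩ := ClassGroup.mk0_surjective g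
  have hJ0 : ((J : Ideal (𝓞 K)) : FractionalIdeal (𝓞 K)⁰ K) ≠ 0 := by
    simpa using nonZeroDivisors.ne_zero J.2
  have h1 : (1 : FractionalIdeal (𝓞 K)⁰ K) ≤ ((J : Ideal (𝓞 K)) : FractionalIdeal (𝓞 K)⁰ K)⁻¹ := by
    have := mul_le_mul_left (FractionalIdeal.coeIdeal_le_one (S := (𝓞 K)⁰) (P := K) (I := J))
      ((J : Ideal (𝓞 K)) : FractionalIdeal (𝓞 K)⁰ K)⁻¹
    rwa [one_mul, mul_inv_cancel₀ hJ0] at this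
  have h2 := key _ ⟨_, h1⟩ rfl
  have h3 : Units.mk0 _ (OverIdeal.ne_zero (⟨_, h1⟩ : OverIdeal (𝓞 K) K)) =
      (FractionalIdeal.mk0 K J)⁻¹ := Units.ext (by simp)
  rw [h3, map_inv, ClassGroup.mk_mk0] at h2
  exact inv_mem_iff.1 h2

/-! ### The seven fields -/

namespace IsSqrtGen

/-- Rounding in `ℤ[δ]` leaves a remainder of norm at most `1 / 4 + D / 4`. -/
theorem isNormCovering_top_of_le_two {D : ℚ} {δ : K} (h : IsSqrtGen D δ) (hD : D ≤ 2)
    (hδ : IsIntegral ℤ δ) : IsNormCovering (⊤ : Ideal (𝓞 K)) := by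
  intro x
  obtain ⟨a, b, rfl⟩ := h.span x
  obtain ⟨d, hd⟩ : ∃ d : 𝓞 K, (d : K) = δ := ⟨⟨δ, hδ⟩, rfl⟩
  refine ⟨-((round a : ℤ) + (round b : ℤ) * d), trivial, ?_⟩
  have h1 : (a : K) + b * δ + ((-((round a : ℤ) + (round b : ℤ) * d) : 𝓞 K) : K) =
      ((a - round a : ℚ) : K) + ((b - round b : ℚ) : K) * δ := by
    simp only [map_neg, map_add, map_mul, map_intCast, hd]
    push_cast
    ring
  have h2 := h.norm_nonneg ((a : K) + b * δ + ((-((round a : ℤ) + (round b : ℤ) * d) : 𝓞 K) : K))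
  rw [abs_of_nonneg h2, h1, h.norm_eq, Ideal.absNorm_top, Nat.cast_one]
  have ha := abs_le.1 (abs_sub_round a)
  have hb := abs_le.1 (abs_sub_round b)
  have ha2 := sq_le_sq' ha.1 ha.2
  have hb2 := sq_le_sq' hb.1 hb.2
  nlinarith [h.pos]

/-- For `D = 4 k - 1` the element `(1 + δ) / 2` is integral, of norm `k`. -/
theorem exists_half_integer {k : ℕ} {δ : K} (h : IsSqrtGen ((4 * k - 1 : ℤ) : ℚ) δ) :
    ∃ ω : 𝓞 K, (ω : K) = 1 / 2 + 1 / 2 * δ ∧ ω * ω = ω - k := by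
  have hsq : ((1 / 2 + 1 / 2 * δ : K)) * (1 / 2 + 1 / 2 * δ) = (1 / 2 + 1 / 2 * δ) - k := by
    have := h.sq
    push_cast at this
    linear_combination (1 / 4) * this
  have hint : IsIntegral ℤ (1 / 2 + 1 / 2 * δ : K) := by
    refine ⟨Polynomial.X ^ 2 + (-Polynomial.X + Polynomial.C (k : ℤ)), ?_, ?_⟩
    · refine Polynomial.monic_X_pow_add ?_
      compute_degree!
    · simp only [Polynomial.eval₂_add, Polynomial.eval₂_pow, Polynomial.eval₂_X,
        Polynomial.eval₂_neg, Polynomial.eval₂_C]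
      simp
      linear_combination hsq
  obtain ⟨ω, hω⟩ : ∃ ω : 𝓞 K, algebraMap (𝓞 K) K ω = 1 / 2 + 1 / 2 * δ := ⟨⟨_, hint⟩, rfl⟩
  refine ⟨ω, hω, FaithfulSMul.algebraMap_injective (𝓞 K) K ?_⟩
  rw [map_mul, map_sub, map_natCast, hω, hsq]

/-- Rounding in `ℤ[(1 + δ) / 2]` leaves a remainder of norm at most `1 / 4 + D / 16`. -/
theorem isNormCovering_top_of_half {k : ℕ} {δ : K} (h : IsSqrtGen ((4 * k - 1 : ℤ) : ℚ) δ)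
    (hk : k ≤ 3) : IsNormCovering (⊤ : Ideal (𝓞 K)) := by
  obtain ⟨ω, hω, -⟩ := h.exists_half_integer
  intro x
  obtain ⟨a, b, rfl⟩ := h.span x
  set v : ℤ := round (2 * b) with hv
  set u : ℤ := round (a - v / 2) with hu
  refine ⟨-((u : ℤ) + (v : ℤ) * ω), trivial, ?_⟩
  have h1 : (a : K) + b * δ + ((-((u : ℤ) + (v : ℤ) * ω) : 𝓞 K) : K) =
      ((a - v / 2 - u : ℚ) : K) + ((b - v / 2 : ℚ) : K) * δ := by
    simp only [map_neg, map_add, map_mul, map_intCast, hω]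
    push_cast
    ring
  have h2 := h.norm_nonneg ((a : K) + b * δ + ((-((u : ℤ) + (v : ℤ) * ω) : 𝓞 K) : K))
  rw [abs_of_nonneg h2, h1, h.norm_eq, Ideal.absNorm_top, Nat.cast_one]
  have ha := abs_le.1 (abs_sub_round (a - v / 2))
  have hb := abs_le.1 (abs_sub_round (2 * b))
  rw [← hu] at ha
  rw [← hv] at hb
  have ha2 := sq_le_sq' ha.1 ha.2
  have hb2 := sq_le_sq' hb.1 hb.2
  have hk' : (k : ℚ) ≤ 3 := by exact_mod_cast hk
  have hk0 : (0 : ℚ) < 4 * k - 1 := by exact_mod_cast h.pos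
  push_cast
  nlinarith

/-- An integer `α = a + b δ` has `2 a ∈ ℤ`, since `2 a = Nm (1 + α) - Nm α - 1`. If `Nm α = 2`, then
`D (8 - (2 a) ^ 2)` is the square of `2 D b`, which fails for the finitely many values of `2 a`. -/
theorem norm_ne_two {D : ℕ} {δ : K} (h : IsSqrtGen (D : ℚ) δ) (hD : D = 5 ∨ D = 15) (α : 𝓞 K) :
    Algebra.norm ℚ (α : K) ≠ 2 := by
  intro hα
  obtain ⟨a, b, hab⟩ := h.span (α : K)
  have h1 := Algebra.coe_norm_int (1 + α)
  have h2 : ((1 + α : 𝓞 K) : K) = ((1 + a : ℚ) : K) + b * δ := by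
    have hab' : algebraMap (𝓞 K) K α = a + b * δ := hab
    change algebraMap (𝓞 K) K (1 + α) = _
    rw [map_add, map_one, hab']
    push_cast
    ring
  rw [h2, h.norm_eq] at h1
  rw [hab, h.norm_eq] at hα
  obtain ⟨k, hk⟩ : ∃ k : ℤ, (k : ℚ) = 2 * a :=
    ⟨Algebra.norm ℤ (1 + α) - 3, by push_cast; rw [h1]; linear_combination hα⟩
  have hsq : IsSquare (((D * (8 - k ^ 2) : ℤ)) : ℚ) :=
    ⟨2 * D * b, by push_cast; rw [hk]; linear_combination (-4 * (D : ℚ)) * hα⟩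
  rw [Rat.isSquare_intCast_iff] at hsq
  have hk8 : k ^ 2 ≤ 8 := by
    have : (k : ℚ) ^ 2 ≤ 8 := by
      rw [hk]; nlinarith [mul_nonneg h.pos.le (sq_nonneg b)]
    exact_mod_cast this
  have hk1 : -2 ≤ k := by nlinarith
  have hk2 : k ≤ 2 := by nlinarith
  rcases hD with rfl | rfl <;> interval_cases k <;> revert hsq <;> norm_num

theorem absNorm_eq_two_of_mul_self {P : Ideal (𝓞 K)} {β : 𝓞 K} (hP : P * P = Ideal.span {β})
    (hβ : |Algebra.norm ℚ (β : K)| = 4) : Ideal.absNorm P = 2 := by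
  rw [abs_norm_coe, ← hP, map_mul] at hβ
  have : Ideal.absNorm P * Ideal.absNorm P = 4 := by exact_mod_cast hβ
  nlinarith

theorem isPrincipal_absNorm_ne_two {D : ℕ} {δ : K} (h : IsSqrtGen (D : ℚ) δ)
    (hD : D = 5 ∨ D = 15) {P : Ideal (𝓞 K)} (hP : P.IsPrincipal) : Ideal.absNorm P ≠ 2 := by
  obtain ⟨α, rfl⟩ := hP
  intro h2
  rw [← Ideal.span] at h2
  have h3 := abs_norm_coe α
  rw [h2, abs_of_nonneg (h.norm_nonneg _)] at h3
  exact h.norm_ne_two hD α (by exact_mod_cast h3)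

/-- An ideal whose square is generated by an element of norm `4` has norm `2`, while no integer has
norm `2`; so its class has order exactly `2`. -/
theorem mk0_sq_eq_one_and_ne_one {D : ℕ} {δ : K} (h : IsSqrtGen (D : ℚ) δ)
    (hD : D = 5 ∨ D = 15) {P : Ideal (𝓞 K)} {β : 𝓞 K} (hP : P * P = Ideal.span {β})
    (hβ : |Algebra.norm ℚ (β : K)| = 4) (hP0 : P ∈ (Ideal (𝓞 K))⁰) :
    ClassGroup.mk0 ⟨P, hP0⟩ ^ 2 = 1 ∧ ClassGroup.mk0 ⟨P, hP0⟩ ≠ 1 := by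
  constructor
  · rw [pow_two, ← map_mul]
    refine (ClassGroup.mk0_eq_one_iff (mul_mem hP0 hP0)).2 ?_
    rw [hP]
    exact ⟨⟨β, rfl⟩⟩
  · rw [Ne, ClassGroup.mk0_eq_one_iff hP0]
    exact fun hpr => h.isPrincipal_absNorm_ne_two hD hpr (absNorm_eq_two_of_mul_self hP hβ)

/-- For `D = 5` the ideal is `(2, 1 + δ)`, with square `(2)`. -/
theorem exists_isNormCovering_five {δ : K} (h : IsSqrtGen (5 : ℕ) δ) :
    ∃ P : (Ideal (𝓞 K))⁰, IsNormCovering (P : Ideal (𝓞 K)) ∧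
      ClassGroup.mk0 P ^ 2 = 1 ∧ ClassGroup.mk0 P ≠ 1 := by
  have hsq : δ ^ 2 = -5 := by simpa using h.sq
  obtain ⟨d, hd⟩ : ∃ d : 𝓞 K, algebraMap (𝓞 K) K d = δ :=
    ⟨⟨δ, IsIntegral.of_pow two_pos (by
      rw [hsq, show (-5 : K) = algebraMap ℤ K (-5) by simp]; exact isIntegral_algebraMap)⟩, rfl⟩
  have hd2 : d * d = -5 := FaithfulSMul.algebraMap_injective (𝓞 K) K (by
    rw [map_mul, hd, ← pow_two, hsq, map_neg, map_ofNat])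
  set P : Ideal (𝓞 K) := Ideal.span {2, 1 + d} with hPdef
  have h2P : (2 : 𝓞 K) ∈ P := Ideal.subset_span (by simp)
  have hdP : 1 + d ∈ P := Ideal.subset_span (by simp)
  have hPP : P * P = Ideal.span {2} := by
    apply le_antisymm
    · rw [hPdef, Ideal.span_mul_span', Ideal.span_le]
      rintro _ ⟨x, hx, y, hy, rfl⟩
      rw [SetLike.mem_coe, Ideal.mem_span_singleton]
      rcases hx with rfl | rfl <;> rcases hy with rfl | rfl
      · exact ⟨2, rfl⟩
      · exact ⟨1 + d, rfl⟩
      · exact ⟨1 + d, by ring⟩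
      · exact ⟨d - 2, by linear_combination hd2⟩
    · rw [Ideal.span_singleton_le_iff_mem]
      have h1 := sub_mem (sub_mem (Ideal.mul_mem_mul h2P hdP) (Ideal.mul_mem_mul hdP hdP))
        (Ideal.mul_mem_mul h2P h2P)
      have h2 : (2 : 𝓞 K) = 2 * (1 + d) - (1 + d) * (1 + d) - 2 * 2 := by
        linear_combination hd2
      rwa [← h2] at h1
  have hn2 : |Algebra.norm ℚ ((2 : 𝓞 K) : K)| = 4 := by
    have := h.norm_eq 2 0
    simp only [Rat.cast_ofNat, Rat.cast_zero, zero_mul, add_zero] at this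
    rw [show ((2 : 𝓞 K) : K) = 2 from map_ofNat _ 2, this]
    norm_num
  have hP0 : P ∈ (Ideal (𝓞 K))⁰ := mem_nonZeroDivisors_of_ne_zero fun h0 => by
    rw [h0] at h2P
    exact two_ne_zero ((Submodule.mem_bot _).1 h2P)
  refine ⟨⟨P, hP0⟩, ?_, h.mk0_sq_eq_one_and_ne_one (Or.inl rfl) hPP hn2 hP0⟩
  -- `P` consists of the `u + v δ` with `u ≡ v` modulo `2`
  have hmem : ∀ u v : ℤ, ((v + 2 * u : ℤ) : 𝓞 K) + (v : 𝓞 K) * d ∈ P := fun u v => by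
    have h1 : ((v + 2 * u : ℤ) : 𝓞 K) + (v : 𝓞 K) * d = u * 2 + v * (1 + d) := by
      push_cast; ring
    rw [h1]
    exact add_mem (P.mul_mem_left _ h2P) (P.mul_mem_left _ hdP)
  intro x
  obtain ⟨a, b, rfl⟩ := h.span x
  have hgoal : ∀ u v : ℤ, (a - v - 2 * u) ^ 2 + 5 * (b - v) ^ 2 < 2 →
      ∃ y ∈ P, |Algebra.norm ℚ ((a : K) + b * δ + (y : K))| < Ideal.absNorm P := fun u v huv => by
    refine ⟨_, neg_mem (hmem u v), ?_⟩
    rw [absNorm_eq_two_of_mul_self hPP hn2, abs_of_nonneg (h.norm_nonneg _)]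
    have h1 : (a : K) + b * δ + ((-(((v + 2 * u : ℤ) : 𝓞 K) + (v : 𝓞 K) * d) : 𝓞 K) : K) =
        ((a - v - 2 * u : ℚ) : K) + ((b - v : ℚ) : K) * δ := by
      simp only [map_neg, map_add, map_mul, map_intCast, hd]
      push_cast
      ring
    rw [h1, h.norm_eq]
    exact_mod_cast huv
  -- the nearest row and, should that fail, the next one with the opposite parity
  set v : ℤ := round b with hv
  have hb := abs_le.1 (abs_sub_round b)
  rw [← hv] at hb
  set u : ℤ := round ((a - v) / 2) with hu
  have ha := abs_le.1 (abs_sub_round ((a - v) / 2))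
  rw [← hu] at ha
  by_cases hlt : (a - v - 2 * u) ^ 2 + 5 * (b - v) ^ 2 < 2
  · exact hgoal u v hlt
  rw [not_lt] at hlt
  have key : ∀ s t : ℚ, 0 ≤ s → s ≤ 1 → 0 ≤ t → t ≤ 1 / 2 → 2 ≤ s ^ 2 + 5 * t ^ 2 →
      (s - 1) ^ 2 + 5 * (t - 1) ^ 2 < 2 := fun s t hs0 hs1 ht0 ht1 hst => by
    have h1 : 2 / 5 ≤ t := by nlinarith
    have h2 : 4 / 5 ≤ s := by nlinarith
    nlinarith
  rcases le_total 0 (a - v - 2 * u) with hA | hA <;> rcases le_total 0 (b - v) with hB | hB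
  · refine hgoal u (v + 1) ?_
    have := key (a - v - 2 * u) (b - v) hA (by linarith) hB (by linarith) hlt
    push_cast
    linarith
  · refine hgoal (u + 1) (v - 1) ?_
    have := key (a - v - 2 * u) (-(b - v)) hA (by linarith) (by linarith) (by linarith)
      (by linarith)
    push_cast
    linarith
  · refine hgoal (u - 1) (v + 1) ?_
    have := key (-(a - v - 2 * u)) (b - v) (by linarith) (by linarith) hB (by linarith)
      (by linarith)
    push_cast
    linarith
  · refine hgoal u (v - 1) ?_
    have := key (-(a - v - 2 * u)) (-(b - v)) (by linarith) (by linarith) (by linarith)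
      (by linarith) (by linarith)
    push_cast
    linarith

/-- For `D = 15` the ideal is `(2, ω)` with `ω = (1 + δ) / 2`, and its square is `(ω)`. Its elements
`2 u + v ω` leave a remainder of norm at most `1 + 15 / 16`. -/
theorem exists_isNormCovering_fifteen {δ : K} (h : IsSqrtGen (15 : ℕ) δ) :
    ∃ P : (Ideal (𝓞 K))⁰, IsNormCovering (P : Ideal (𝓞 K)) ∧
      ClassGroup.mk0 P ^ 2 = 1 ∧ ClassGroup.mk0 P ≠ 1 := by
  obtain ⟨ω, hω, hω2⟩ := exists_half_integer (k := 4) (δ := δ) (by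
    convert h using 1; norm_num)
  push_cast at hω2
  set P : Ideal (𝓞 K) := Ideal.span {2, ω} with hPdef
  have h2P : (2 : 𝓞 K) ∈ P := Ideal.subset_span (by simp)
  have hωP : ω ∈ P := Ideal.subset_span (by simp)
  have hPP : P * P = Ideal.span {ω} := by
    apply le_antisymm
    · rw [hPdef, Ideal.span_mul_span', Ideal.span_le]
      rintro _ ⟨x, hx, y, hy, rfl⟩
      rw [SetLike.mem_coe, Ideal.mem_span_singleton]
      rcases hx with hx | hx <;> rcases hy with hy | hy <;> rw [hx, hy]
      · exact ⟨1 - ω, by linear_combination hω2⟩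
      · exact ⟨2, by ring⟩
      · exact ⟨2, by ring⟩
      · exact ⟨ω, rfl⟩
    · rw [Ideal.span_singleton_le_iff_mem]
      have h1 := add_mem (Ideal.mul_mem_mul hωP hωP) (Ideal.mul_mem_mul h2P h2P)
      have h2 : ω = ω * ω + 2 * 2 := by linear_combination -hω2
      rwa [← h2] at h1
  have hn : |Algebra.norm ℚ (ω : K)| = 4 := by
    have := h.norm_eq (1 / 2) (1 / 2)
    push_cast at this
    rw [hω, this]
    norm_num
  have hP0 : P ∈ (Ideal (𝓞 K))⁰ := mem_nonZeroDivisors_of_ne_zero fun h0 => by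
    rw [h0] at h2P
    exact two_ne_zero ((Submodule.mem_bot _).1 h2P)
  refine ⟨⟨P, hP0⟩, ?_, h.mk0_sq_eq_one_and_ne_one (Or.inr rfl) hPP hn hP0⟩
  intro x
  obtain ⟨a, b, rfl⟩ := h.span x
  set v : ℤ := round (2 * b) with hv
  set u : ℤ := round ((a - v / 2) / 2) with hu
  refine ⟨-((u : ℤ) * 2 + (v : ℤ) * ω),
    neg_mem (add_mem (P.mul_mem_left _ h2P) (P.mul_mem_left _ hωP)), ?_⟩
  have h1 : (a : K) + b * δ + ((-((u : ℤ) * 2 + (v : ℤ) * ω) : 𝓞 K) : K) =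
      ((a - v / 2 - 2 * u : ℚ) : K) + ((b - v / 2 : ℚ) : K) * δ := by
    simp only [map_neg, map_add, map_mul, map_intCast, hω, map_ofNat]
    push_cast
    ring
  rw [absNorm_eq_two_of_mul_self hPP hn, abs_of_nonneg (h.norm_nonneg _), h1, h.norm_eq]
  have ha := abs_le.1 (abs_sub_round ((a - v / 2) / 2))
  have hb := abs_le.1 (abs_sub_round (2 * b))
  rw [← hu] at ha
  rw [← hv] at hb
  have ha2 := sq_le_sq' ha.1 ha.2
  have hb2 := sq_le_sq' hb.1 hb.2
  push_cast
  nlinarith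

theorem isNormCovering_top {D : ℕ} {δ : K} (h : IsSqrtGen (D : ℚ) δ)
    (hD : D ∈ ({1, 2, 3, 7, 11} : Set ℕ)) : IsNormCovering (⊤ : Ideal (𝓞 K)) := by
  have hint : IsIntegral ℤ δ := IsIntegral.of_pow two_pos (by
    rw [h.sq, show (-((D : ℚ) : K)) = algebraMap ℤ K (-D) by simp]; exact isIntegral_algebraMap)
  simp only [Set.mem_insert_iff, Set.mem_singleton_iff] at hD
  rcases hD with rfl | rfl | rfl | rfl | rfl
  · exact h.isNormCovering_top_of_le_two (by norm_num) hint
  · exact h.isNormCovering_top_of_le_two (by norm_num) hint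
  · exact isNormCovering_top_of_half (k := 1) (δ := δ) (by convert h using 1; norm_num)
      (by norm_num)
  · exact isNormCovering_top_of_half (k := 2) (δ := δ) (by convert h using 1; norm_num)
      (by norm_num)
  · exact isNormCovering_top_of_half (k := 3) (δ := δ) (by convert h using 1; norm_num)
      (by norm_num)

end IsSqrtGen

/-! ### Class numbers and the generating class -/

theorem classNumber_eq_one_of_generates (h : GeneratesClassGroup (1 : ClassGroup (𝓞 K))) :
    NumberField.classNumber K = 1 := by
  rw [NumberField.classNumber, ← Nat.card_eq_fintype_card, ← Subgroup.card_top, ← h,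
    Subgroup.zpowers_one_eq_bot, Subgroup.card_bot]

theorem classNumber_eq_two_of_generates {c : ClassGroup (𝓞 K)} (h : GeneratesClassGroup c)
    (h2 : c ^ 2 = 1) (h1 : c ≠ 1) : NumberField.classNumber K = 2 := by
  rw [NumberField.classNumber, ← Nat.card_eq_fintype_card, ← Subgroup.card_top, ← h,
    Nat.card_zpowers, orderOf_eq_prime h2 h1]

/-- A cyclic group of order at most `2` has a single generator. -/
theorem generates_iff_of_sq_eq_one {R : Type*} [CommRing R] [IsDomain R] {c : ClassGroup R}
    (h : GeneratesClassGroup c) (h2 : c ^ 2 = 1) (g : ClassGroup R) :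
    GeneratesClassGroup g ↔ g = c := by
  refine ⟨fun hg => ?_, fun hg => hg ▸ h⟩
  have hmem : ∀ x : ClassGroup R, x = 1 ∨ x = c := fun x => by
    have hx : x ∈ Subgroup.zpowers c := h ▸ Subgroup.mem_top x
    obtain ⟨n, rfl⟩ := hx
    rcases Int.even_or_odd' n with ⟨k, rfl | rfl⟩
    · left
      simp only [zpow_mul]
      rw [zpow_ofNat, h2, one_zpow]
    · right
      simp only [zpow_add, zpow_mul, zpow_one]
      rw [zpow_ofNat, h2, one_zpow, one_mul]
  rcases hmem g with rfl | h'
  · have hc : c ∈ Subgroup.zpowers (1 : ClassGroup R) := hg ▸ Subgroup.mem_top c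
    rw [Subgroup.zpowers_one_eq_bot, Subgroup.mem_bot] at hc
    exact hc.symm
  · exact h'

theorem IsNormCovering.exists_unique_class {C : (Ideal (𝓞 K))⁰}
    (h : IsNormCovering (C : Ideal (𝓞 K))) (h2 : ClassGroup.mk0 C ^ 2 = 1) :
    ∃ c : ClassGroup (𝓞 K), (∀ g : ClassGroup (𝓞 K), GeneratesClassGroup g ↔ g = c) ∧
      ∀ C : (Ideal (𝓞 K))⁰, ClassGroup.mk0 C = c → IsNormEuclidean (C : Ideal (𝓞 K)) :=
  ⟨ClassGroup.mk0 C,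
    generates_iff_of_sq_eq_one h.isNormEuclidean.isEuclidean.generatesClassGroup h2,
    fun _ hC' => (h.of_mk0_eq hC'.symm).isNormEuclidean⟩

theorem IsSqrtGen.exists_isNormCovering {D : ℕ} {δ : K}
    (h : IsSqrtGen (D : ℚ) δ) (hD : D ∈ ({5, 15} : Set ℕ)) :
    ∃ P : (Ideal (𝓞 K))⁰, IsNormCovering (P : Ideal (𝓞 K)) ∧
      ClassGroup.mk0 P ^ 2 = 1 ∧ ClassGroup.mk0 P ≠ 1 := by
  rcases hD with rfl | rfl
  · exact h.exists_isNormCovering_five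
  · exact h.exists_isNormCovering_fifteen


end EuclideanIdeal

theorem theorem1 (K : Type*) [Field K] [NumberField K] :
    -- The imaginary quadratic fields with a Euclidean ideal are exactly the seven listed ones.
    ((EuclideanIdeal.IsImaginaryQuadratic K ∧
        ∃ C : Ideal (𝓞 K), EuclideanIdeal.IsEuclidean K C) ↔
      ∃ D : ℕ, D ∈ ({1, 2, 3, 7, 11, 5, 15} : Set ℕ) ∧
        Nonempty (K ≃ₐ[ℚ] EuclideanIdeal.QSqrtNeg D)) ∧
    -- The seven fields are pairwise non-isomorphic.
    (∀ D ∈ ({1, 2, 3, 7, 11, 5, 15} : Set ℕ), ∀ D' ∈ ({1, 2, 3, 7, 11, 5, 15} : Set ℕ),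
      Nonempty (K ≃ₐ[ℚ] EuclideanIdeal.QSqrtNeg D) →
        Nonempty (K ≃ₐ[ℚ] EuclideanIdeal.QSqrtNeg D') → D = D') ∧
    -- Their class numbers.
    (∀ D ∈ ({1, 2, 3, 7, 11} : Set ℕ), Nonempty (K ≃ₐ[ℚ] EuclideanIdeal.QSqrtNeg D) →
      NumberField.classNumber K = 1) ∧
    (∀ D ∈ ({5, 15} : Set ℕ), Nonempty (K ≃ₐ[ℚ] EuclideanIdeal.QSqrtNeg D) →
      NumberField.classNumber K = 2) ∧
    -- In each of them exactly one class generates the class group, and it is norm-Euclidean.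
    (∀ D ∈ ({1, 2, 3, 7, 11, 5, 15} : Set ℕ),
      Nonempty (K ≃ₐ[ℚ] EuclideanIdeal.QSqrtNeg D) →
        ∃ c : ClassGroup (𝓞 K),
          (∀ g : ClassGroup (𝓞 K), EuclideanIdeal.GeneratesClassGroup g ↔ g = c) ∧
          ∀ C : (Ideal (𝓞 K))⁰, ClassGroup.mk0 C = c →
            EuclideanIdeal.IsNormEuclidean (C : Ideal (𝓞 K))) := by
  open EuclideanIdeal in
  have hpos : ∀ D ∈ ({1, 2, 3, 7, 11, 5, 15} : Set ℕ), 0 < D := by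
    simp
  have hsplit : ∀ D ∈ ({1, 2, 3, 7, 11, 5, 15} : Set ℕ),
      D ∈ ({1, 2, 3, 7, 11} : Set ℕ) ∨ D ∈ ({5, 15} : Set ℕ) := by
    simp
  have hone : ∀ D ∈ ({1, 2, 3, 7, 11} : Set ℕ), Nonempty (K ≃ₐ[ℚ] QSqrtNeg D) →
      IsNormCovering ((1 : (Ideal (𝓞 K))⁰) : Ideal (𝓞 K)) := fun D hD e => by
    have hD0 : 0 < D := by rcases hD with rfl | rfl | rfl | rfl | rfl <;> norm_num
    obtain ⟨δ, h⟩ := (nonempty_algEquiv_iff hD0).1 e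
    rw [Submonoid.coe_one, Ideal.one_eq_top]
    exact h.isNormCovering_top hD
  have hone' : ClassGroup.mk0 (1 : (Ideal (𝓞 K))⁰) = 1 := map_one _
  have htwo : ∀ D ∈ ({5, 15} : Set ℕ), Nonempty (K ≃ₐ[ℚ] QSqrtNeg D) →
      ∃ P : (Ideal (𝓞 K))⁰, IsNormCovering (P : Ideal (𝓞 K)) ∧
        ClassGroup.mk0 P ^ 2 = 1 ∧ ClassGroup.mk0 P ≠ 1 := fun D hD e => by
    have hD0 : 0 < D := by rcases hD with rfl | rfl <;> norm_num
    obtain ⟨δ, h⟩ := (nonempty_algEquiv_iff hD0).1 e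
    exact h.exists_isNormCovering hD
  have hcover : ∀ D ∈ ({1, 2, 3, 7, 11, 5, 15} : Set ℕ), Nonempty (K ≃ₐ[ℚ] QSqrtNeg D) →
      ∃ P : (Ideal (𝓞 K))⁰, IsNormCovering (P : Ideal (𝓞 K)) ∧ ClassGroup.mk0 P ^ 2 = 1 :=
    fun D hD e => by
      rcases hsplit D hD with hD | hD
      · exact ⟨1, hone D hD e, by rw [hone', one_pow]⟩
      · obtain ⟨P, hP, h2, -⟩ := htwo D hD e
        exact ⟨P, hP, h2⟩
  refine ⟨⟨?_, ?_⟩, ?_, ?_, ?_, ?_⟩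
  · rintro ⟨hK, C, hC⟩
    obtain ⟨D, hD, hδ⟩ := hC.exists_isSqrtGen hK
    exact ⟨D, hD, (nonempty_algEquiv_iff (hpos D hD)).2 hδ⟩
  · rintro ⟨D, hD, e⟩
    obtain ⟨δ, h⟩ := (nonempty_algEquiv_iff (hpos D hD)).1 e
    obtain ⟨P, hP, -⟩ := hcover D hD e
    exact ⟨h.isImaginaryQuadratic, P, hP.isNormEuclidean.isEuclidean⟩
  · intro D hD D' hD' e e'
    obtain ⟨δ, h⟩ := (nonempty_algEquiv_iff (hpos D hD)).1 e
    obtain ⟨δ', h'⟩ := (nonempty_algEquiv_iff (hpos D' hD')).1 e'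
    have hsq := isSquare_of_isSqrtGen h h'
    simp only [Set.mem_insert_iff, Set.mem_singleton_iff] at hD hD'
    rcases hD with rfl | rfl | rfl | rfl | rfl | rfl | rfl <;>
      rcases hD' with rfl | rfl | rfl | rfl | rfl | rfl | rfl <;>
      first | rfl | (exact absurd hsq (by norm_num))
  · intro D hD e
    have := (hone D hD e).isNormEuclidean.isEuclidean
    exact classNumber_eq_one_of_generates
      (hone' ▸ this.generatesClassGroup)
  · intro D hD e
    obtain ⟨P, hP, h2, h1⟩ := htwo D hD e
    exact classNumber_eq_two_of_generates
      hP.isNormEuclidean.isEuclidean.generatesClassGroup h2 h1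
  · intro D hD e
    obtain ⟨P, hP, h2⟩ := hcover D hD e
    exact hP.exists_unique_class h2
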